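/- For an election with a finite nonempty candidate set $C$ and a list of voters $V=(v_1,\dots,v_n)$, each $v_i$ being a linear order on $C$, let $\mathrm{pos}_v(c)$ be the position of $c$ in $v$. For linear orders $u,v$ on the same candidate set let $d_{\mathrm{Spear}}(u,v)=\sum_{c\in C}|\mathrm{pos}_v(c)-\mathrm{pos}_u(c)|$, and let $d_{\mathrm{swap}}(u,v)$ be the smallest number of swaps of consecutive candidates that transform $u$ into $v$. For $d\in\{d_{\mathrm{Spear}},d_{\mathrm{swap}}\}$ and elections $E=(C,(v_1,\dots,v_n))$ and $E'=(C',(v'_1,\dots,v'_n))$ with $|C|=|C'|$, the $d$-isomorphic distance is $$d\text{-ID}(E,E')=\min_{\nu\in S_n}\ \min_{\sigma\colon C\to C'\text{ bijection}}\ \sum_{i=1}^n d\bigl(\sigma(v_i),v'_{\nu(i)}\bigr),$$ where $\sigma(v)$ is the order on $C'$ that ranks $\sigma(c)$ where $v$ ranks $c$. In the optimization problem $d$-ID, such a pair $E,E'$ is given and $d\text{-ID}(E,E')$ is to be computed. A polynomial-time $|V|^\alpha$-approximation algorithm for $d$-ID is a polynomial-time algorithm that, for every such pair of elections with $n=|V|$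 voters each, outputs a natural number $s$ (in binary) with $d\text{-ID}(E,E')\le s\le n^\alpha\cdot d\text{-ID}(E,E')$. Theorem. Suppose that the Graph Isomorphism problem (given two finite simple graphs, decide whether they are isomorphic) is not in $\mathrm{P}$. Then for every real $\alpha\ge 1$ there is no polynomial-time $|V|^\alpha$-approximation algorithm for $d_{\mathrm{Spear}}$-ID, and there is no polynomial-time $|V|^\alpha$-approximation algorithm for $d_{\mathrm{swap}}$-ID. -/

import Mathlib

namespace ElectionIso

/-! ### Preference orders, elections and isomorphic distances -/

/-- A preference order (vote) over a set `C` of `m` candidates. The linear order is given by its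
ranking bijection: `v c` is the place of `c`, counted from `0` (the most appealing candidate), so
`v` prefers `a` to `b` iff `v a < v b`. -/
abbrev Vote (C : Type) (m : ℕ) := C ≃ Fin m

/-- The position of candidate `c` in the vote `v`; the top-ranked candidate has position `1`. -/
def pos {C : Type} {m : ℕ} (v : Vote C m) (c : C) : ℕ := (v c : ℕ) + 1

/-- The Spearman distance: the total displacement of the candidates. -/
def dSpear {C : Type} [Fintype C] {m : ℕ} (u v : Vote C m) : ℕ :=
  ∑ c : C, ((pos v c : ℤ) - (pos u c : ℤ)).natAbs

/-- `w` arises from `u` by swapping two consecutive candidates. -/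
def AdjacentSwap {C : Type} {m : ℕ} (u w : Vote C m) : Prop :=
  ∃ p q : Fin m, (q : ℕ) = (p : ℕ) + 1 ∧ w = u.trans (Equiv.swap p q)

/-- The swap distance: the smallest number of swaps of consecutive candidates that
transform `u` into `v`. -/
noncomputable def dSwap {C : Type} {m : ℕ} (u v : Vote C m) : ℕ :=
  sInf {t : ℕ | ∃ s : ℕ → Vote C m, s 0 = u ∧ s t = v ∧ ∀ i < t, AdjacentSwap (s i) (s (i + 1))}

/-- The preference collection `(v_1, …, v_n)` of an election with candidate set `C`. -/
abbrev Election (C : Type) (m n : ℕ) := Fin n → Vote C m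

/-- The vote `σ(v)`, which ranks `σ c` where `v` ranks `c`. -/
def renameVote {C D : Type} {m : ℕ} (σ : C ≃ D) (v : Vote C m) : Vote D m := σ.symm.trans v

/-- The `d`-isomorphic distance of two elections with the same numbers of candidates and voters:
the minimum over all voter matchings `ν` and candidate matchings `σ`. -/
noncomputable def isoDist {C D : Type} {m n : ℕ} (d : Vote D m → Vote D m → ℕ)
    (E : Election C m n) (F : Election D m n) : ℕ :=
  ⨅ ν : Equiv.Perm (Fin n), ⨅ σ : C ≃ D, ∑ i : Fin n, d (renameVote σ (E i)) (F (ν i))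

/-- An input of the (optimization variant of the) isomorphic distance problem: two elections with
the same number of voters and the same positive number of candidates, the candidates of either
one being named `0, …, numCand - 1`. -/
structure Instance where
  numCand : ℕ
  numCand_pos : 0 < numCand
  numVoters : ℕ
  fst : Election (Fin numCand) numCand numVoters
  snd : Election (Fin numCand) numCand numVoters

/-- The value to be computed in `d_Spear`-ID. -/
noncomputable def spearID (I : Instance) : ℕ := isoDist dSpear I.fst I.snd

/-- The value to be computed in `d_swap`-ID. -/
noncomputable def swapID (I : Instance) : ℕ := isoDist dSwap I.fst I.snd

/-! ### Encodings of the inputs as bit strings -/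

/-- The self-delimiting code `1…10` of a number. -/
def encodeNum (k : ℕ) : List Bool := List.replicate k true ++ [false]

/-- Voter by voter, the list of the candidates from the most to the least appealing one.
Names of candidates may be written in unary, since every vote lists all candidates anyway. -/
def encodeElection {m n : ℕ} (E : Election (Fin m) m n) : List Bool :=
  (List.finRange n).flatMap fun i =>
    (List.finRange m).flatMap fun p => encodeNum ((E i).symm p : ℕ)

/-- The numbers of candidates and of voters, followed by the two elections. -/
def encodeInstance (I : Instance) : List Bool :=
  encodeNum I.numCand ++ encodeNum I.numVoters ++ encodeElection I.fst ++ encodeElection I.snd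

/-- An input of Graph Isomorphism: two finite simple graphs on the vertex sets
`{0, …, vtxFst - 1}` and `{0, …, vtxSnd - 1}`. -/
structure GraphPair where
  vtxFst : ℕ
  vtxSnd : ℕ
  fst : SimpleGraph (Fin vtxFst)
  snd : SimpleGraph (Fin vtxSnd)

open Classical in
/-- The number of vertices, followed by the adjacency matrix row by row. -/
noncomputable def encodeGraph {n : ℕ} (G : SimpleGraph (Fin n)) : List Bool :=
  encodeNum n ++ (List.finRange n).flatMap fun i => (List.finRange n).map fun j => decide (G.Adj i j)

noncomputable def encodeGraphPair (P : GraphPair) : List Bool :=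
  encodeGraph P.fst ++ encodeGraph P.snd

/-! ### Polynomial time -/

/-- A function on `A` with natural values, written in binary, is computable in polynomial time
(by a Turing machine, in the length of the encoded argument). -/
def PolyTimeNat {A : Type} (enc : A → List Bool) (f : A → ℕ) : Prop :=
  Nonempty (Turing.TM2ComputableInPolyTime enc Computability.encodeNat f)

open Classical in
/-- The decision problem `Q` on inputs from `A` is in the class P. -/
def InP {A : Type} (enc : A → List Bool) (Q : A → Prop) : Prop :=
  Nonempty (Turing.TM2ComputableInPolyTime enc Computability.encodeBool fun a => decide (Q a))

/-- Graph Isomorphism is in P. -/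
def GraphIsomorphismInP : Prop :=
  InP encodeGraphPair fun P => Nonempty (P.fst ≃g P.snd)

/-- There is a polynomial-time `ρ`-approximation algorithm for the minimum `opt`: on every input
`I` it outputs a number between `opt I` and `ρ I * opt I`. -/
def HasPolyTimeApprox (opt : Instance → ℕ) (ρ : Instance → ℝ) : Prop :=
  ∃ f : Instance → ℕ, PolyTimeNat encodeInstance f ∧
    ∀ I : Instance, opt I ≤ f I ∧ (f I : ℝ) ≤ ρ I * (opt I : ℝ)

end ElectionIso

/-! The proof is a gap reduction from Graph Isomorphism. A graph on `n` vertices becomes an election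
with one voter per vertex, whose candidates are the vertices and `2 * D` dummies. Voter `i` ranks
`i`, then `D` dummies, then the neighbours of `i`, then the other `D` dummies, then the remaining
vertices (`voteList`).

An isomorphism `φ` of the graphs matches voters and vertex candidates, the dummies being fixed. It
respects the groups of every vote, so only pairs of vertices can be inverted, and the swap distance
is at most `n ^ 3` (`swapID_graphInstance_le`). Conversely, suppose that some matching has Spearman
distance `t` with `2 * t + n < D`. No candidate can then cross a block of dummies, and this forces
the matching to send vertices to vertices, to agree on voters and vertices, and to preserve
adjacency (`nonempty_iso_of_spearID_lt`).

Since the Spearman distance is at most twice the swap distance (`dSpear_le_two_mul_dSwap`), both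
problems are handled at once, for any `opt` lying between the two up to factors of 2. With `k = ⌈α⌉`
and `D = (n + 2) ^ (k + 8)`, the gap exceeds the approximation ratio by so much that the binary
length `ℓ` of the approximate value already decides isomorphism: the test is `2 ^ (ℓ + 3) ≤ D`.

The rest is a verified implementation. Program fragments for multi-stack machines are combined with
explicit time bounds; the resulting program writes the instance, runs the given approximation
machine on stacks of its own, halves a unary `D` once per output digit and three times more, and
checks whether anything is left (`runs_mainProg_of_eq`, `graphIsomorphismInP_of_polyTimeNat`). -/

open Turing Finset

namespace ElectionIso

/-! ### Comparison of the swap and Spearman distances of votes. -/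

section Distances

variable {C : Type} [Fintype C] {m : ℕ}

theorem dSpear_triangle (u w v : Vote C m) : dSpear u v ≤ dSpear u w + dSpear w v := by
  unfold dSpear
  rw [← Finset.sum_add_distrib]
  exact Finset.sum_le_sum fun c _ => by omega

theorem dSpear_self (u : Vote C m) : dSpear u u = 0 := by
  simp [dSpear]

/-- Only two candidates move, each by one place; hence the factor 2 between the two distances. -/
theorem dSpear_le_two_of_adjacentSwap {u w : Vote C m} (h : AdjacentSwap u w) :
    dSpear u w ≤ 2 := by
  obtain ⟨p, q, hpq, rfl⟩ := h
  have h1 : dSpear u (u.trans (Equiv.swap p q)) =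
      ∑ x : Fin m, (((Equiv.swap p q x : ℕ) : ℤ) - (x : ℕ)).natAbs := by
    unfold dSpear
    refine Fintype.sum_equiv u _ _ fun c => ?_
    simp [pos]
  have h2 : ∀ x : Fin m, (((Equiv.swap p q x : ℕ) : ℤ) - (x : ℕ)).natAbs ≤
      (if x = p then 1 else 0) + (if x = q then 1 else 0) := by
    intro x
    by_cases hx : x = p
    · subst hx
      simp only [Equiv.swap_apply_left, if_true]
      omega
    · by_cases hy : x = q
      · subst hy
        simp only [Equiv.swap_apply_right, if_true]
        omega
      · simp [Equiv.swap_apply_of_ne_of_ne hx hy]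
  rw [h1]
  refine (Finset.sum_le_sum fun x _ => h2 x).trans ?_
  simp [Finset.sum_add_distrib]

theorem dSpear_le_two_mul_of_swaps (t : ℕ) (s : ℕ → Vote C m)
    (h : ∀ i < t, AdjacentSwap (s i) (s (i + 1))) : dSpear (s 0) (s t) ≤ 2 * t := by
  induction t with
  | zero => simp [dSpear_self]
  | succ t ih =>
    have h1 := ih fun i hi => h i (by omega)
    have h2 := dSpear_le_two_of_adjacentSwap (h t (by omega))
    have h3 := dSpear_triangle (s 0) (s t) (s (t + 1))
    omega

/-- The pairs of candidates on which two votes disagree. -/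
def inversions (u v : Vote C m) : Finset (C × C) :=
  Finset.univ.filter fun x => u x.1 < u x.2 ∧ v x.2 < v x.1

theorem mem_inversions {u v : Vote C m} {a b : C} :
    (a, b) ∈ inversions u v ↔ u a < u b ∧ v b < v a := by
  simp [inversions]

omit [Fintype C] in
-- Without a descent at consecutive places, `u.symm.trans v` is a strictly monotone bijection of
-- `Fin m`, and the identity is the only one.
theorem exists_descent {u v : Vote C m} (h : u ≠ v) :
    ∃ p q : Fin m, (q : ℕ) = (p : ℕ) + 1 ∧ v (u.symm q) < v (u.symm p) := by
  by_contra! hc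
  apply h
  cases m with
  | zero => exact Equiv.ext fun c => (u c).elim0
  | succ k =>
    have hmono : StrictMono (u.symm.trans v) := by
      rw [Fin.strictMono_iff_lt_succ]
      intro i
      refine lt_of_le_of_ne (hc i.castSucc i.succ (by simp)) fun he => ?_
      have := (u.symm.trans v).injective he
      simp [Fin.ext_iff] at this
    have h1 : ∀ x, u.symm.trans v x = x := fun x => by
      have := DFunLike.congr_fun (Subsingleton.elim
        (StrictMono.orderIsoOfSurjective _ hmono (u.symm.trans v).surjective)
        (OrderIso.refl (Fin (k + 1)))) x
      simpa using this
    refine Equiv.ext fun c => ?_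
    simpa using (h1 (u c)).symm

/-- Exchanging neighbours changes the relative order of that pair only, so the inverted pair
disappears and no inversion is created. -/
theorem card_inversions_swap_lt {u v : Vote C m} {p q : Fin m} (hpq : (q : ℕ) = (p : ℕ) + 1)
    (h : v (u.symm q) < v (u.symm p)) :
    (inversions (u.trans (Equiv.swap p q)) v).card < (inversions u v).card := by
  refine Finset.card_lt_card ?_
  rw [Finset.ssubset_iff_of_subset]
  · refine ⟨(u.symm p, u.symm q), ?_, ?_⟩
    · simp only [mem_inversions, Equiv.apply_symm_apply]
      exact ⟨by rw [Fin.lt_def]; omega, h⟩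
    · simp only [mem_inversions, Equiv.trans_apply,
        Equiv.apply_symm_apply, Equiv.swap_apply_left, Equiv.swap_apply_right, not_and]
      intro hlt
      rw [Fin.lt_def] at hlt
      omega
  · rintro ⟨a, b⟩
    simp only [mem_inversions, Equiv.trans_apply]
    rintro ⟨h1, h2⟩
    refine ⟨?_, h2⟩
    have ha : a = u.symm (u a) := by simp
    have hb : b = u.symm (u b) := by simp
    generalize u a = x at *
    generalize u b = y at *
    subst ha hb
    by_cases hxp : x = p
    · subst hxp
      rw [Equiv.swap_apply_left] at h1
      by_cases hyq : y = q
      · subst hyq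
        rw [Fin.lt_def]; omega
      · by_cases hyp : y = x
        · subst hyp; exact absurd h2 (lt_irrefl _)
        · rw [Equiv.swap_apply_of_ne_of_ne hyp hyq] at h1
          rw [Fin.lt_def] at h1 ⊢; omega
    · by_cases hxq : x = q
      · subst hxq
        rw [Equiv.swap_apply_right] at h1
        by_cases hyp : y = p
        · subst hyp
          exact absurd (h.trans h2) (lt_irrefl _)
        · by_cases hyq : y = x
          · subst hyq; exact absurd h2 (lt_irrefl _)
          · rw [Equiv.swap_apply_of_ne_of_ne hyp hyq] at h1
            rw [Fin.lt_def] at h1 ⊢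
            have := Fin.val_ne_of_ne hyq
            omega
      · rw [Equiv.swap_apply_of_ne_of_ne hxp hxq] at h1
        by_cases hyp : y = p
        · subst hyp
          rw [Equiv.swap_apply_left] at h1
          rw [Fin.lt_def] at h1 ⊢
          have := Fin.val_ne_of_ne hxp
          omega
        · by_cases hyq : y = q
          · subst hyq
            rw [Equiv.swap_apply_right] at h1
            rw [Fin.lt_def] at h1 ⊢; omega
          · rwa [Equiv.swap_apply_of_ne_of_ne hyp hyq] at h1

/-- Bubble sort: as long as the votes differ there is a descent at consecutive places, and swapping
it lowers the number of inversions. -/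
theorem exists_swaps (v : Vote C m) (k : ℕ) : ∀ u : Vote C m, (inversions u v).card ≤ k →
    ∃ t ≤ k, ∃ s : ℕ → Vote C m, s 0 = u ∧ s t = v ∧ ∀ i < t, AdjacentSwap (s i) (s (i + 1)) := by
  induction k with
  | zero =>
    intro u hu
    by_cases h : u = v
    · exact ⟨0, le_rfl, fun _ => u, rfl, h, by simp⟩
    · obtain ⟨p, q, hpq, hd⟩ := exists_descent h
      have := card_inversions_swap_lt hpq hd
      omega
  | succ k ih =>
    intro u hu
    by_cases h : u = v
    · exact ⟨0, by omega, fun _ => u, rfl, h, by simp⟩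
    · obtain ⟨p, q, hpq, hd⟩ := exists_descent h
      have := card_inversions_swap_lt hpq hd
      obtain ⟨t, ht, s, h0, h1, h2⟩ := ih (u.trans (Equiv.swap p q)) (by omega)
      refine ⟨t + 1, by omega, fun i => Nat.casesOn i u s, rfl, h1, ?_⟩
      intro i hi
      cases i with
      | zero => exact ⟨p, q, hpq, h0⟩
      | succ i => exact h2 i (by omega)

theorem dSwap_le_card_inversions (u v : Vote C m) : dSwap u v ≤ (inversions u v).card := by
  obtain ⟨t, ht, hs⟩ := exists_swaps v _ u le_rfl
  exact (Nat.sInf_le hs).trans ht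

theorem dSpear_le_two_mul_dSwap (u v : Vote C m) : dSpear u v ≤ 2 * dSwap u v := by
  -- The infimum of the empty set would be `0`; a sequence of swaps must exist for `dSwap` to be
  -- attained.
  obtain ⟨t, -, hs⟩ := exists_swaps v _ u le_rfl
  obtain ⟨s, h0, h1, h2⟩ := Nat.sInf_mem (s := {t : ℕ | ∃ s : ℕ → Vote C m, s 0 = u ∧ s t = v ∧
    ∀ i < t, AdjacentSwap (s i) (s (i + 1))}) ⟨t, hs⟩
  have := dSpear_le_two_mul_of_swaps _ s h2
  rwa [h0, h1] at this

end Distances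

/-! ### General bounds for isomorphic distances. -/

section IsoDist

variable {m n : ℕ}

theorem isoDist_le {C D : Type} {d : Vote D m → Vote D m → ℕ} {E : Election C m n}
    {F : Election D m n} (ν : Equiv.Perm (Fin n)) (σ : C ≃ D) :
    isoDist d E F ≤ ∑ i : Fin n, d (renameVote σ (E i)) (F (ν i)) :=
  (ciInf_le (OrderBot.bddBelow _) ν).trans (ciInf_le (OrderBot.bddBelow _) σ)

theorem exists_isoDist_eq {C D : Type} [Nonempty (C ≃ D)] (d : Vote D m → Vote D m → ℕ)
    (E : Election C m n) (F : Election D m n) :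
    ∃ (ν : Equiv.Perm (Fin n)) (σ : C ≃ D),
      isoDist d E F = ∑ i : Fin n, d (renameVote σ (E i)) (F (ν i)) := by
  obtain ⟨ν, hν⟩ := Nat.sInf_mem (Set.range_nonempty
    fun ν : Equiv.Perm (Fin n) => ⨅ σ : C ≃ D, ∑ i : Fin n, d (renameVote σ (E i)) (F (ν i)))
  obtain ⟨σ, hσ⟩ := Nat.sInf_mem (Set.range_nonempty
    fun σ : C ≃ D => ∑ i : Fin n, d (renameVote σ (E i)) (F (ν i)))
  exact ⟨ν, σ, (hν.symm.trans hσ.symm)⟩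

theorem spearID_le_two_mul_swapID (I : Instance) : spearID I ≤ 2 * swapID I := by
  obtain ⟨ν, σ, h⟩ := exists_isoDist_eq dSwap I.fst I.snd
  rw [swapID, h, Finset.mul_sum]
  exact (isoDist_le ν σ).trans (Finset.sum_le_sum fun i _ => dSpear_le_two_mul_dSwap _ _)

/-- A crude bound that needs no isomorphism; it serves to keep the output of the approximation
algorithm short on all instances. -/
theorem swapID_le (I : Instance) : swapID I ≤ I.numVoters * (I.numCand * I.numCand) := by
  refine (isoDist_le 1 (Equiv.refl _)).trans ?_
  have : ∀ i ∈ (Finset.univ : Finset (Fin I.numVoters)),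
      dSwap (renameVote (Equiv.refl _) (I.fst i)) (I.snd ((1 : Equiv.Perm (Fin I.numVoters)) i)) ≤
        I.numCand * I.numCand := fun i _ =>
    (dSwap_le_card_inversions _ _).trans ((Finset.card_le_univ _).trans (by simp))
  simpa using Finset.sum_le_card_nsmul _ _ _ this

end IsoDist

/-! ### Votes and elections built from graphs. -/

/-- The vote which lists the candidates in the order of `L`. -/
def listVote {m : ℕ} (L : List ℕ) (h : L.Perm (List.range m)) : Vote (Fin m) m where
  toFun c := ⟨L.idxOf (c : ℕ), by
    have := List.idxOf_lt_length_of_mem (h.mem_iff.2 (List.mem_range.2 c.isLt))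
    rwa [h.length_eq, List.length_range] at this⟩
  invFun p := ⟨L[(p : ℕ)]'(by rw [h.length_eq, List.length_range]; exact p.isLt),
    List.mem_range.1 (h.mem_iff.1 (List.getElem_mem _))⟩
  left_inv c := by simp
  right_inv p := by
    have hn : L.Nodup := h.nodup_iff.2 List.nodup_range
    simp [hn.idxOf_getElem]

theorem listVote_apply {m : ℕ} (L : List ℕ) (h : L.Perm (List.range m)) (c : Fin m) :
    (listVote L h c : ℕ) = L.idxOf (c : ℕ) := rfl

theorem flatMap_listVote_symm {m : ℕ} {β : Type} (L : List ℕ) (h : L.Perm (List.range m))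
    (f : ℕ → List β) :
    ((List.finRange m).flatMap fun p => f ((listVote L h).symm p : ℕ)) = L.flatMap f := by
  have hl : L.length = m := by rw [h.length_eq, List.length_range]
  subst hl
  have : L = (List.finRange L.length).map (fun p : Fin L.length => L[(p : ℕ)]) :=
    (List.map_getElem_finRange L).symm
  conv_rhs => rw [this]
  rw [List.flatMap_map]
  rfl

/-- The vertices other than `i` below `n` whose bit is set. -/
def topVertices (n i : ℕ) (a : ℕ → Bool) : List ℕ :=
  (List.range n).filter fun j => j ≠ i && a j

/-- The vertices other than `i` below `n` whose bit is not set. -/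
def bottomVertices (n i : ℕ) (a : ℕ → Bool) : List ℕ :=
  (List.range n).filter fun j => j ≠ i && !a j

/-- The vote of vertex `i`: first `i` itself, then its neighbours (given by the bits `a`), then the
other vertices, these groups being separated by `D` dummies each. -/
def voteList (n D i : ℕ) (a : ℕ → Bool) : List ℕ :=
  [i] ++ (List.range' n D ++ (topVertices n i a ++ (List.range' (n + D) D ++
    (bottomVertices n i a).reverse)))

theorem mem_topVertices {n i : ℕ} {a : ℕ → Bool} {c : ℕ} :
    c ∈ topVertices n i a ↔ c < n ∧ c ≠ i ∧ a c = true := by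
  simp [topVertices]

theorem mem_bottomVertices {n i : ℕ} {a : ℕ → Bool} {c : ℕ} :
    c ∈ bottomVertices n i a ↔ c < n ∧ c ≠ i ∧ a c = false := by
  simp [bottomVertices]

theorem length_topVertices_le (n i : ℕ) (a : ℕ → Bool) : (topVertices n i a).length ≤ n :=
  (List.length_filter_le _ _).trans_eq List.length_range

theorem voteList_perm {n D i : ℕ} (a : ℕ → Bool) (hi : i < n) :
    (voteList n D i a).Perm (List.range (n + 2 * D)) := by
  have ht : (topVertices n i a).Nodup := List.nodup_range.filter _
  have hb : (bottomVertices n i a).Nodup := List.nodup_range.filter _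
  have hr : ∀ s, (List.range' s D).Nodup := fun s => List.nodup_range'
  refine (List.perm_ext_iff_of_nodup ?_ List.nodup_range).2 fun c => ?_
  · simp only [voteList, List.nodup_append, List.nodup_reverse, List.mem_append, List.mem_reverse,
      List.mem_range'_1, mem_topVertices, mem_bottomVertices, ht, hb, hr,
      List.nodup_singleton, List.mem_singleton, true_and]
    refine ⟨⟨⟨?_, ?_⟩, ?_⟩, ?_⟩
    · rintro x hx y ⟨hy, -⟩; omega
    · rintro x ⟨hx, h1, h2⟩ y (hy | ⟨hy, h3, h4⟩)
      · omega
      · rintro rfl; simp_all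
    · rintro x hx y (⟨hy, -⟩ | hy | ⟨hy, -⟩) <;> omega
    · rintro x rfl y (hy | ⟨hy, h1, -⟩ | hy | ⟨hy, h1, -⟩) <;>
        first | exact h1.symm | omega
  · simp only [voteList, List.mem_append, List.mem_reverse,
      List.mem_range'_1, mem_topVertices, mem_bottomVertices, List.mem_singleton, List.mem_range]
    constructor
    · rintro (h | h | h | h | h) <;> omega
    · intro h
      by_cases hc : c < n
      · by_cases hci : c = i
        · exact Or.inl hci
        · cases hac : a c <;> simp [hc, hci]
      · omega

/-- One alternative for each of the five groups of the vote. The places of dummies are exact; for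
the neighbours and non-neighbours bounds suffice, as the order inside these groups plays no role. -/
theorem idxOf_voteList {n D i : ℕ} (a : ℕ → Bool) (hi : i < n) {c : ℕ} (hc : c < n + 2 * D) :
    (c = i ∧ (voteList n D i a).idxOf c = 0) ∨
    (n ≤ c ∧ c < n + D ∧ (voteList n D i a).idxOf c = 1 + (c - n)) ∨
    ((c < n ∧ c ≠ i ∧ a c = true) ∧ 1 + D ≤ (voteList n D i a).idxOf c ∧
      (voteList n D i a).idxOf c < 1 + D + (topVertices n i a).length) ∨
    (n + D ≤ c ∧ (voteList n D i a).idxOf c = 1 + (topVertices n i a).length + (c - n)) ∨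
    ((c < n ∧ c ≠ i ∧ a c = false) ∧
      1 + 2 * D + (topVertices n i a).length ≤ (voteList n D i a).idxOf c) := by
  have hr : ∀ s : ℕ, s ≤ c → c < s + D → (List.range' s D).idxOf c = c - s := by
    intro s h1 h2
    have h3 : (List.range' s D)[c - s]'(by simp; omega) = c := by simp; omega
    conv_lhs => rw [← h3]
    have hn : (List.range' s D).Nodup := List.nodup_range'
    exact hn.idxOf_getElem _ _
  by_cases hci : c = i
  · left
    subst hci
    simp [voteList]
  right
  unfold voteList
  rw [List.idxOf_append_of_notMem (by simpa using hci)]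
  by_cases h1 : n ≤ c ∧ c < n + D
  · left
    rw [List.idxOf_append_of_mem (by simpa using h1), hr n h1.1 h1.2]
    simp [h1]
  right
  rw [List.idxOf_append_of_notMem (by simpa using h1)]
  by_cases h2 : c ∈ topVertices n i a
  · left
    rw [List.idxOf_append_of_mem h2]
    have := List.idxOf_lt_length_of_mem h2
    refine ⟨mem_topVertices.1 h2, ?_⟩
    simp only [List.length_singleton, List.length_range']
    omega
  right
  rw [List.idxOf_append_of_notMem h2]
  by_cases h3 : n + D ≤ c
  · left
    rw [List.idxOf_append_of_mem (by simp; omega), hr (n + D) h3 (by omega)]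
    simp only [List.length_singleton, List.length_range']
    omega
  right
  rw [List.idxOf_append_of_notMem (by simp; omega)]
  have hcn : c < n := by omega
  refine ⟨⟨hcn, hci, ?_⟩, ?_⟩
  · rw [mem_topVertices] at h2
    simpa [hcn, hci] using h2
  · simp only [List.length_singleton, List.length_range']
    omega

/-- The entry of the adjacency matrix of `G` in row `i` and column `j`. -/
noncomputable def adjBit {n : ℕ} (G : SimpleGraph (Fin n)) (i j : ℕ) : Bool :=
  open Classical in decide (∃ (hi : i < n) (hj : j < n), G.Adj ⟨i, hi⟩ ⟨j, hj⟩)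

theorem adjBit_eq_true {n : ℕ} {G : SimpleGraph (Fin n)} (i j : Fin n) :
    adjBit G i j = true ↔ G.Adj i j := by
  simp [adjBit]

/-- The election of a graph, with one voter for each vertex. -/
noncomputable def graphElection {n : ℕ} (D : ℕ) (G : SimpleGraph (Fin n)) :
    Election (Fin (n + 2 * D)) (n + 2 * D) n := fun i =>
  listVote (voteList n D i (adjBit G i)) (voteList_perm _ i.isLt)

/-- The instance of the isomorphic distance problem obtained from two graphs. -/
noncomputable def graphInstance {n : ℕ} (D : ℕ) (hD : 0 < D) (G H : SimpleGraph (Fin n)) :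
    Instance where
  numCand := n + 2 * D
  numCand_pos := by omega
  numVoters := n
  fst := graphElection D G
  snd := graphElection D H

/-! ### Graph isomorphism versus isomorphic distance. -/

section Correctness

variable {n D : ℕ}

/-- The number of neighbours of the vertex `i`. -/
noncomputable def numTop (G : SimpleGraph (Fin n)) (i : Fin n) : ℕ :=
  (topVertices n i (adjBit G i)).length

theorem numTop_le (G : SimpleGraph (Fin n)) (i : Fin n) : numTop G i ≤ n :=
  length_topVertices_le _ _ _

theorem graphElection_self (G : SimpleGraph (Fin n)) (i : Fin n) :
    (graphElection D G i (Fin.castAdd _ i) : ℕ) = 0 := by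
  rw [graphElection, listVote_apply]
  simp [voteList]

theorem graphElection_adj {G : SimpleGraph (Fin n)} {i j : Fin n} (h : G.Adj i j) :
    1 + D ≤ (graphElection D G i (Fin.castAdd _ j) : ℕ) ∧
      (graphElection D G i (Fin.castAdd _ j) : ℕ) < 1 + D + numTop G i := by
  rw [graphElection, listVote_apply]
  have hb := (adjBit_eq_true (G := G) i j).2 h
  have hne : (j : ℕ) ≠ i := fun e => h.ne (Fin.ext e.symm)
  have hs := idxOf_voteList (D := D) (adjBit G i) i.isLt (c := j) (by omega)
  have hj := j.isLt
  simp [hb] at hs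
  simp only [numTop, Fin.val_castAdd]
  omega

theorem graphElection_not_adj {G : SimpleGraph (Fin n)} {i j : Fin n} (hne : i ≠ j)
    (h : ¬ G.Adj i j) :
    1 + 2 * D + numTop G i ≤ (graphElection D G i (Fin.castAdd _ j) : ℕ) := by
  rw [graphElection, listVote_apply]
  have hb : adjBit G i j = false := by
    rw [← Bool.not_eq_true, adjBit_eq_true]; exact h
  have hne : (j : ℕ) ≠ i := fun e => hne (Fin.ext e.symm)
  have hs := idxOf_voteList (D := D) (adjBit G i) i.isLt (c := j) (by omega)
  have hj := j.isLt
  simp [hb] at hs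
  simp only [numTop, Fin.val_castAdd]
  omega

/-- The place of a dummy depends on the vote only through the degree of the voter, so it varies by
at most `n` from vote to vote. -/
theorem graphElection_dummy (G : SimpleGraph (Fin n)) (i : Fin n) (k : Fin (2 * D)) :
    ((k : ℕ) < D ∧ (graphElection D G i (Fin.natAdd n k) : ℕ) = 1 + k) ∨
    (D ≤ k ∧ (graphElection D G i (Fin.natAdd n k) : ℕ) = 1 + numTop G i + k) := by
  rw [graphElection, listVote_apply]
  have := idxOf_voteList (D := D) (adjBit G i) i.isLt (c := n + k) (by omega)
  have := i.isLt
  simp only [numTop, Fin.val_natAdd]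
  omega

/-- The candidate matching which maps the vertices by `φ` and fixes the dummies. -/
def vertexMatching (D : ℕ) (φ : Equiv.Perm (Fin n)) : Equiv.Perm (Fin (n + 2 * D)) :=
  finSumFinEquiv.permCongr (Equiv.sumCongr φ (Equiv.refl _))

theorem vertexMatching_castAdd (φ : Equiv.Perm (Fin n)) (j : Fin n) :
    vertexMatching D φ (Fin.castAdd _ j) = Fin.castAdd _ (φ j) := by
  simp [vertexMatching, Equiv.permCongr_apply]

theorem vertexMatching_natAdd (φ : Equiv.Perm (Fin n)) (k : Fin (2 * D)) :
    vertexMatching D φ (Fin.natAdd n k) = Fin.natAdd n k := by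
  simp [vertexMatching, Equiv.permCongr_apply]

/-- An isomorphism keeps every candidate in its group. The alternatives list inequalities between
places, so that inversions can be excluded by linear arithmetic. -/
theorem graphElection_vertexMatching {G H : SimpleGraph (Fin n)} (φ : G ≃g H) (i : Fin n)
    (c : Fin (n + 2 * D)) :
    ((∃ j, c = Fin.castAdd _ j) ∧
      (((graphElection D G i c : ℕ) = 0 ∧
        (graphElection D H (φ i) (vertexMatching D φ.toEquiv c) : ℕ) = 0) ∨
      (1 + D ≤ (graphElection D G i c : ℕ) ∧ (graphElection D G i c : ℕ) < 1 + D + numTop G i ∧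
        1 + D ≤ (graphElection D H (φ i) (vertexMatching D φ.toEquiv c) : ℕ) ∧
        (graphElection D H (φ i) (vertexMatching D φ.toEquiv c) : ℕ) <
          1 + D + numTop H (φ i)) ∨
      (1 + 2 * D + numTop G i ≤ (graphElection D G i c : ℕ) ∧
        1 + 2 * D + numTop H (φ i) ≤
          (graphElection D H (φ i) (vertexMatching D φ.toEquiv c) : ℕ)))) ∨
    ∃ k < 2 * D, (k < D ∧ (graphElection D G i c : ℕ) = 1 + k ∧
        (graphElection D H (φ i) (vertexMatching D φ.toEquiv c) : ℕ) = 1 + k) ∨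
      (D ≤ k ∧ (graphElection D G i c : ℕ) = 1 + numTop G i + k ∧
        (graphElection D H (φ i) (vertexMatching D φ.toEquiv c) : ℕ) =
          1 + numTop H (φ i) + k) := by
  induction c using Fin.addCases with
  | left j =>
    refine Or.inl ⟨⟨j, rfl⟩, ?_⟩
    rw [vertexMatching_castAdd]
    by_cases hij : i = j
    · subst hij
      exact Or.inl ⟨graphElection_self _ _, graphElection_self _ _⟩
    · by_cases ha : G.Adj i j
      · have h1 := graphElection_adj (D := D) ha
        have h2 := graphElection_adj (D := D) (φ.map_adj_iff.2 ha)
        exact Or.inr (Or.inl ⟨h1.1, h1.2, h2.1, h2.2⟩)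
      · exact Or.inr (Or.inr ⟨graphElection_not_adj hij ha,
          graphElection_not_adj (φ.injective.ne hij) (fun h => ha (φ.map_adj_iff.1 h))⟩)
  | right k =>
    right
    rw [vertexMatching_natAdd]
    refine ⟨k, k.isLt, ?_⟩
    have h1 := graphElection_dummy G i k
    have h2 := graphElection_dummy H (φ i) k
    omega

theorem swapID_graphInstance_le (hD : 0 < D) {G H : SimpleGraph (Fin n)} (φ : G ≃g H) :
    swapID (graphInstance D hD G H) ≤ n * (n * n) := by
  refine (isoDist_le (E := graphElection D G) (F := graphElection D H) φ.toEquiv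
    (vertexMatching D φ.toEquiv)).trans ?_
  have key : ∀ i ∈ (Finset.univ : Finset (Fin n)),
      dSwap (renameVote (vertexMatching D φ.toEquiv) (graphElection D G i))
        (graphElection D H (φ.toEquiv i)) ≤ n * n := by
    intro i _
    refine (dSwap_le_card_inversions _ _).trans ?_
    have hsub : inversions (renameVote (vertexMatching D φ.toEquiv) (graphElection D G i))
        (graphElection D H (φ.toEquiv i)) ⊆
        (Finset.univ : Finset (Fin n × Fin n)).image
          fun x => (vertexMatching D φ.toEquiv (Fin.castAdd _ x.1),
            vertexMatching D φ.toEquiv (Fin.castAdd _ x.2)) := by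
      rintro ⟨a, b⟩ hab
      obtain ⟨a, rfl⟩ := (vertexMatching D φ.toEquiv).surjective a
      obtain ⟨b, rfl⟩ := (vertexMatching D φ.toEquiv).surjective b
      rw [mem_inversions] at hab
      simp only [renameVote, Equiv.trans_apply, Equiv.symm_apply_apply, Fin.lt_def] at hab
      obtain ⟨h1, h2⟩ := hab
      have ha := graphElection_vertexMatching φ i a
      have hb := graphElection_vertexMatching φ i b
      -- Dummies come in the same order in both votes, and a vertex lies on the same side of each
      -- dummy in both, so an inversion cannot involve a dummy.
      have hv : (∃ j, a = Fin.castAdd _ j) ∧ ∃ j, b = Fin.castAdd _ j := by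
        change _ < ((graphElection D H (φ i)) _ : ℕ) at h2
        change ((graphElection D H (φ i)) _ : ℕ) < _ at h2
        have hg := numTop_le G i
        have hh := numTop_le H (φ i)
        rcases ha with ⟨ha, ha'⟩ | ⟨k, hk, ha⟩ <;> rcases hb with ⟨hb, hb'⟩ | ⟨l, hl, hb⟩
        · exact ⟨ha, hb⟩
        all_goals omega
      obtain ⟨⟨j, rfl⟩, ⟨k, rfl⟩⟩ := hv
      exact Finset.mem_image.2 ⟨(j, k), Finset.mem_univ _, rfl⟩
    refine (Finset.card_le_card hsub).trans (Finset.card_image_le.trans ?_)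
    simp
  refine (Finset.sum_le_card_nsmul _ _ _ key).trans ?_
  simp

theorem natAbs_le_sum_dSpear {m : ℕ} {E F : Election (Fin m) m n} (ν : Equiv.Perm (Fin n))
    (σ : Equiv.Perm (Fin m)) (i : Fin n) (c : Fin m) :
    ((F (ν i) (σ c) : ℤ) - (E i c : ℤ)).natAbs ≤
      ∑ i : Fin n, dSpear (renameVote σ (E i)) (F (ν i)) := by
  have h1 : ((F (ν i) (σ c) : ℤ) - (E i c : ℤ)).natAbs ≤ dSpear (renameVote σ (E i)) (F (ν i)) := by
    refine le_trans (le_of_eq ?_) (Finset.single_le_sum (f := fun c : Fin m =>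
      ((pos (F (ν i)) c : ℤ) - (pos (renameVote σ (E i)) c : ℤ)).natAbs)
      (fun _ _ => Nat.zero_le _) (Finset.mem_univ (σ c)))
    simp [pos, renameVote]
  exact h1.trans (Finset.single_le_sum (f := fun i => dSpear (renameVote σ (E i)) (F (ν i)))
    (fun _ _ => Nat.zero_le _) (Finset.mem_univ i))

/-- In an optimal matching every candidate is displaced by at most the total `t` in every vote,
which is too little to cross a block of `D` dummies. -/
theorem nonempty_iso_of_spearID_lt (hD : 0 < D) {G H : SimpleGraph (Fin n)}
    (h : 2 * spearID (graphInstance D hD G H) + n < D) : Nonempty (G ≃g H) := by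
  obtain ⟨ν, σ, hs⟩ := exists_isoDist_eq dSpear (graphElection D G) (graphElection D H)
  have hlt : 2 * (∑ i : Fin n, dSpear (renameVote σ (graphElection D G i))
      (graphElection D H (ν i))) + n < D := by
    rw [← hs]; exact h
  have hb := natAbs_le_sum_dSpear (E := graphElection D G) (F := graphElection D H) ν σ
  generalize (∑ i : Fin n, dSpear (renameVote σ (graphElection D G i))
      (graphElection D H (ν i))) = t at hlt hb
  -- The argument for `hvert` needs a second voter; graphs with at most one vertex are isomorphic
  -- anyway.
  by_cases hn : n ≤ 1
  · have : Subsingleton (Fin n) := Fin.subsingleton_iff_le_one.2 hn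
    refine ⟨⟨Equiv.refl _, ?_⟩⟩
    intro a b
    rw [Subsingleton.elim b a]
    simp
  -- Voter `j` ranks `j` first and any other voter ranks it below `D` dummies, whereas the places of
  -- a dummy differ by at most `n`. Matching `j` with a dummy would give `1 + D ≤ 2 * t + n`.
  have hvert : ∀ j : Fin n, ∃ k : Fin n, σ (Fin.castAdd _ j) = Fin.castAdd _ k := by
    intro j
    by_contra hc
    obtain ⟨k, hk⟩ : ∃ k : Fin (2 * D), σ (Fin.castAdd _ j) = Fin.natAdd n k := by
      generalize σ (Fin.castAdd _ j) = c at hc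
      induction c using Fin.addCases with
      | left l => exact absurd ⟨l, rfl⟩ hc
      | right l => exact ⟨l, rfl⟩
    obtain ⟨i, hij⟩ : ∃ i : Fin n, i ≠ j := by
      have : Nontrivial (Fin n) := Fin.nontrivial_iff_two_le.2 (by omega)
      exact exists_ne j
    have h1 := hb j (Fin.castAdd _ j)
    have h2 := hb i (Fin.castAdd _ j)
    rw [hk] at h1 h2
    have h3 := graphElection_self (D := D) G j
    have h4 := graphElection_dummy H (ν j) k
    have h5 := graphElection_dummy H (ν i) k
    have h6 := numTop_le H (ν j)
    have h7 := numTop_le H (ν i)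
    have h8 : 1 + D ≤ (graphElection D G i (Fin.castAdd _ j) : ℕ) := by
      by_cases ha : G.Adj i j
      · exact (graphElection_adj ha).1
      · have := graphElection_not_adj (D := D) hij ha
        omega
    omega
  choose τ hτ using hvert
  -- Candidate `i` is on top for voter `i`, but `τ i` is on top for voter `ν i` only if the two
  -- coincide; otherwise at least `1 + D` candidates precede it.
  have hdiag : ∀ i, τ i = ν i := by
    intro i
    by_contra hc
    have h1 := hb i (Fin.castAdd _ i)
    rw [hτ] at h1
    have h3 := graphElection_self (D := D) G i
    have h8 : 1 + D ≤ (graphElection D H (ν i) (Fin.castAdd _ (τ i)) : ℕ) := by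
      by_cases ha : H.Adj (ν i) (τ i)
      · exact (graphElection_adj ha).1
      · have := graphElection_not_adj (D := D) (Ne.symm hc) ha
        omega
    omega
  refine ⟨⟨ν, ?_⟩⟩
  intro i j
  by_cases hij : i = j
  · subst hij; simp
  have h1 := hb i (Fin.castAdd _ j)
  rw [hτ, hdiag] at h1
  have hg := numTop_le G i
  have hh := numTop_le H (ν i)
  -- A pair adjacent in just one graph would be moved across the second block of dummies; as degrees
  -- are at most `n`, this is a displacement of more than `D - n`.
  constructor
  · intro ha
    by_contra hc
    have h2 := graphElection_adj (D := D) ha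
    have h3 := graphElection_not_adj (D := D) hij hc
    omega
  · intro ha
    by_contra hc
    have h2 := graphElection_adj (D := D) ha
    have h3 := graphElection_not_adj (D := D) (ν.injective.ne hij) hc
    omega

end Correctness

/-! ### Program fragments for multi-stack machines. -/

section Fragments

variable {K : Type} [DecidableEq K] {Γ : K → Type} {Λ Λ' σ : Type}

/-- A run of exactly `t` steps of the program `M`. -/
inductive Steps (M : Λ → TM2.Stmt Γ Λ σ) : ℕ → TM2.Cfg Γ Λ σ → TM2.Cfg Γ Λ σ → Prop
  | refl (c : TM2.Cfg Γ Λ σ) : Steps M 0 c c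
  | head {t : ℕ} {c c₁ c₂ : TM2.Cfg Γ Λ σ} (h : TM2.step M c = some c₁)
      (h' : Steps M t c₁ c₂) : Steps M (t + 1) c c₂

theorem Steps.trans {M : Λ → TM2.Stmt Γ Λ σ} {t₁ t₂ : ℕ} {a b c : TM2.Cfg Γ Λ σ}
    (h₁ : Steps M t₁ a b) (h₂ : Steps M t₂ b c) : Steps M (t₁ + t₂) a c := by
  induction h₁ with
  | refl c => simpa using h₂
  | head h _ ih =>
    rw [Nat.add_right_comm]
    exact Steps.head h (ih h₂)

/-- This and `Steps.of_iterate` translate between `Steps` and the iterated partial step function in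
which machine runs are stated: the given machine is taken over in one direction, the constructed one
delivered in the other. -/
theorem Steps.iterate {M : Λ → TM2.Stmt Γ Λ σ} {t : ℕ} {a b : TM2.Cfg Γ Λ σ}
    (h : Steps M t a b) : (flip bind (TM2.step M))^[t] (some a) = some b := by
  induction h with
  | refl c => rfl
  | head h _ ih =>
    rw [Function.iterate_succ_apply, ← ih]
    congr 1

theorem iterate_bind_none {α : Type*} (f : α → Option α) (t : ℕ) :
    (flip bind f)^[t] none = none := by
  induction t with
  | zero => rfl
  | succ t ih => rw [Function.iterate_succ_apply]; exact ih

theorem Steps.of_iterate {M : Λ → TM2.Stmt Γ Λ σ} {t : ℕ} :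
    ∀ {a b : TM2.Cfg Γ Λ σ}, (flip bind (TM2.step M))^[t] (some a) = some b → Steps M t a b := by
  induction t with
  | zero =>
    intro a b h
    cases h
    exact Steps.refl _
  | succ t ih =>
    intro a b h
    rw [Function.iterate_succ_apply] at h
    cases hs : TM2.step M a with
    | none =>
      have : flip bind (TM2.step M) (some a) = none := hs
      rw [this, iterate_bind_none] at h
      cases h
    | some c =>
      have : flip bind (TM2.step M) (some a) = some c := hs
      rw [this] at h
      exact Steps.head hs (ih h)

/-- Rename the labels of a statement, and jump to `e` instead of halting. -/
def relabel (f : Λ → Λ') (e : Option Λ') : TM2.Stmt Γ Λ σ → TM2.Stmt Γ Λ' σ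
  | .push k g q => .push k g (relabel f e q)
  | .peek k g q => .peek k g (relabel f e q)
  | .pop k g q => .pop k g (relabel f e q)
  | .load g q => .load g (relabel f e q)
  | .branch g q₁ q₂ => .branch g (relabel f e q₁) (relabel f e q₂)
  | .goto l => .goto fun v => f (l v)
  | .halt => e.elim .halt fun l => .goto fun _ => l

theorem stepAux_relabel (f : Λ → Λ') (e : Option Λ') (q : TM2.Stmt Γ Λ σ) (v : σ)
    (S : ∀ k, List (Γ k)) :
    TM2.stepAux (relabel f e q) v S =
      ⟨((TM2.stepAux q v S).l.map f).or e, (TM2.stepAux q v S).var, (TM2.stepAux q v S).stk⟩ := by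
  induction q generalizing v S with
  | branch g q₁ q₂ h₁ h₂ => cases hg : g v <;> simp [relabel, hg, h₁, h₂]
  | halt => cases e <;> simp [relabel]
  | goto l => simp [relabel]
  | _ => simp_all [relabel]

/-- A halted configuration has no successor, so redirecting the halts to `e` alters only the last
configuration of the run. -/
theorem Steps.relabel {M : Λ → TM2.Stmt Γ Λ σ} {M' : Λ' → TM2.Stmt Γ Λ' σ} {f : Λ → Λ'}
    {e : Option Λ'} (hM : ∀ l, M' (f l) = ElectionIso.relabel f e (M l)) {t : ℕ} {l : Λ} {v v' : σ}
    {S S' : ∀ k, List (Γ k)} (h : Steps M t ⟨some l, v, S⟩ ⟨none, v', S'⟩) :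
    Steps M' t ⟨some (f l), v, S⟩ ⟨e, v', S'⟩ := by
  generalize hc : (⟨some l, v, S⟩ : TM2.Cfg Γ Λ σ) = c at h
  generalize hc' : (⟨none, v', S'⟩ : TM2.Cfg Γ Λ σ) = c' at h
  induction h generalizing l v S with
  | refl c => subst hc; cases hc'
  | @head t c c₁ c₂ h h' ih =>
    subst hc
    simp only [TM2.step, Option.some.injEq] at h
    refine Steps.head (c₁ := TM2.stepAux (M' (f l)) v S) rfl ?_
    rw [hM, stepAux_relabel, h]
    obtain ⟨l₁, v₁, S₁⟩ := c₁
    cases l₁ with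
    | some l₁ => exact ih rfl hc'
    | none =>
      subst hc'
      cases h' with
      | refl => exact Steps.refl _
      | head h _ => simp at h

variable (Γ σ) in
/-- A program fragment: it is entered at `entry` and left by halting. -/
structure Frag where
  Λ : Type
  fin : Fintype Λ
  entry : Λ
  code : Λ → TM2.Stmt Γ Λ σ

/-- Started with memory `v` and stacks `S`, the fragment is left with memory `v` and stacks `S'`
after at most `T` steps. -/
def Frag.Runs (F : Frag Γ σ) (v : σ) (S : ∀ k, List (Γ k)) (T : ℕ) (S' : ∀ k, List (Γ k)) : Prop :=
  ∃ t ≤ T, Steps F.code t ⟨some F.entry, v, S⟩ ⟨none, v, S'⟩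

theorem Frag.Runs.mono {F : Frag Γ σ} {v : σ} {S S' S'' : ∀ k, List (Γ k)} {T T' : ℕ}
    (h : F.Runs v S T S') (hT : T ≤ T') (hS : S' = S'') : F.Runs v S T' S'' := by
  obtain ⟨t, ht, h⟩ := h
  exact ⟨t, ht.trans hT, hS ▸ h⟩

/-- Run `F`, then `G`. -/
def Frag.seq (F G : Frag Γ σ) : Frag Γ σ where
  Λ := F.Λ ⊕ G.Λ
  fin := @instFintypeSum _ _ F.fin G.fin
  entry := .inl F.entry
  code
    | .inl l => relabel .inl (some (.inr G.entry)) (F.code l)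
    | .inr l => relabel .inr none (G.code l)

theorem Frag.Runs.seq {F G : Frag Γ σ} {v : σ} {S S₁ S₂ : ∀ k, List (Γ k)} {T₁ T₂ : ℕ}
    (h₁ : F.Runs v S T₁ S₁) (h₂ : G.Runs v S₁ T₂ S₂) : (F.seq G).Runs v S (T₁ + T₂) S₂ := by
  obtain ⟨t₁, ht₁, h₁⟩ := h₁
  obtain ⟨t₂, ht₂, h₂⟩ := h₂
  refine ⟨t₁ + t₂, by omega, Steps.trans
    (Steps.relabel (M' := (F.seq G).code) (fun _ => rfl) h₁)
    (Steps.relabel (M' := (F.seq G).code) (fun _ => rfl) h₂)⟩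

/-- Do nothing. -/
def Frag.skip : Frag Γ σ where
  Λ := Unit
  fin := inferInstance
  entry := ()
  code _ := .halt

theorem Frag.runs_skip (v : σ) (S : ∀ k, List (Γ k)) : (Frag.skip : Frag Γ σ).Runs v S 1 S :=
  ⟨1, le_rfl, Steps.head rfl (Steps.refl _)⟩

/-- Push `x` to the stack `k`. -/
def Frag.push (k : K) (x : Γ k) : Frag Γ σ where
  Λ := Unit
  fin := inferInstance
  entry := ()
  code _ := .push k (fun _ => x) .halt

theorem Frag.runs_push (k : K) (x : Γ k) (v : σ) (S : ∀ k, List (Γ k)) :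
    (Frag.push k x : Frag Γ σ).Runs v S 1 (Function.update S k (x :: S k)) :=
  ⟨1, le_rfl, Steps.head rfl (Steps.refl _)⟩

variable {τ : Type}

/-- Pop from the stack `k`, and go on at a label depending on the outcome. -/
def popJump (k : K) (dec : Γ k → Bool) (qn qf qt : TM2.Stmt Γ Λ (Option Bool × τ)) :
    TM2.Stmt Γ Λ (Option Bool × τ) :=
  -- The first memory component holds the outcome only within this statement; it is `none` again
  -- whenever a jump is made.
  .pop k (fun v o => (o.map dec, v.2)) <|
    .branch (fun v => v.1 == some true) (.load (fun v => (none, v.2)) qt) <|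
      .branch (fun v => v.1 == some false) (.load (fun v => (none, v.2)) qf) qn

theorem stepAux_popJump_nil {k : K} {dec : Γ k → Bool}
    {qn qf qt : TM2.Stmt Γ Λ (Option Bool × τ)} {w : τ} {S : ∀ k, List (Γ k)} (h : S k = []) :
    TM2.stepAux (popJump k dec qn qf qt) (none, w) S = TM2.stepAux qn (none, w) S := by
  simp [popJump, h]
  rw [← h, Function.update_eq_self]

theorem stepAux_popJump_cons {k : K} {dec : Γ k → Bool}
    {qn qf qt : TM2.Stmt Γ Λ (Option Bool × τ)} {w : τ} {S : ∀ k, List (Γ k)} {x : Γ k}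
    {l : List (Γ k)} (h : S k = x :: l) :
    TM2.stepAux (popJump k dec qn qf qt) (none, w) S =
      TM2.stepAux (if dec x then qt else qf) (none, w) (Function.update S k l) := by
  cases hx : dec x <;> simp [popJump, h, hx]

/-- Pop from the stack `k`, and run `FN` if it was empty, or `FF` or `FT` according to the bit
found. -/
def Frag.popCase (k : K) (dec : Γ k → Bool) (FN FF FT : Frag Γ (Option Bool × τ)) :
    Frag Γ (Option Bool × τ) where
  Λ := Option (FN.Λ ⊕ (FF.Λ ⊕ FT.Λ))
  fin := @instFintypeOption _ (@instFintypeSum _ _ FN.fin (@instFintypeSum _ _ FF.fin FT.fin))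
  entry := none
  code
    | none => popJump k dec (.goto fun _ => some (.inl FN.entry))
        (.goto fun _ => some (.inr (.inl FF.entry))) (.goto fun _ => some (.inr (.inr FT.entry)))
    | some (.inl l) => relabel (fun l => some (.inl l)) none (FN.code l)
    | some (.inr (.inl l)) => relabel (fun l => some (.inr (.inl l))) none (FF.code l)
    | some (.inr (.inr l)) => relabel (fun l => some (.inr (.inr l))) none (FT.code l)

theorem Frag.runs_popCase_nil {k : K} {dec : Γ k → Bool} {FN FF FT : Frag Γ (Option Bool × τ)}
    {w : τ} {S S' : ∀ k, List (Γ k)} {T : ℕ} (hk : S k = []) (h : FN.Runs (none, w) S T S') :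
    (Frag.popCase k dec FN FF FT).Runs (none, w) S (T + 1) S' := by
  obtain ⟨t, ht, h⟩ := h
  exact ⟨t + 1, by omega, Steps.head (congrArg some (stepAux_popJump_nil hk))
    (Steps.relabel (M' := (Frag.popCase k dec FN FF FT).code)
      (f := fun l => some (.inl l)) (fun _ => rfl) h)⟩

theorem Frag.runs_popCase_false {k : K} {dec : Γ k → Bool} {FN FF FT : Frag Γ (Option Bool × τ)}
    {w : τ} {S S' : ∀ k, List (Γ k)} {T : ℕ} {x : Γ k} {l : List (Γ k)} (hk : S k = x :: l)
    (hx : dec x = false) (h : FF.Runs (none, w) (Function.update S k l) T S') :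
    (Frag.popCase k dec FN FF FT).Runs (none, w) S (T + 1) S' := by
  obtain ⟨t, ht, h⟩ := h
  refine ⟨t + 1, by omega, Steps.head (congrArg some (stepAux_popJump_cons hk)) ?_⟩
  rw [hx]
  exact Steps.relabel (M' := (Frag.popCase k dec FN FF FT).code)
      (f := fun l => some (.inr (.inl l))) (fun _ => rfl) h

theorem Frag.runs_popCase_true {k : K} {dec : Γ k → Bool} {FN FF FT : Frag Γ (Option Bool × τ)}
    {w : τ} {S S' : ∀ k, List (Γ k)} {T : ℕ} {x : Γ k} {l : List (Γ k)} (hk : S k = x :: l)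
    (hx : dec x = true) (h : FT.Runs (none, w) (Function.update S k l) T S') :
    (Frag.popCase k dec FN FF FT).Runs (none, w) S (T + 1) S' := by
  obtain ⟨t, ht, h⟩ := h
  refine ⟨t + 1, by omega, Steps.head (congrArg some (stepAux_popJump_cons hk)) ?_⟩
  rw [hx]
  exact Steps.relabel (M' := (Frag.popCase k dec FN FF FT).code)
      (f := fun l => some (.inr (.inr l))) (fun _ => rfl) h

/-- Pop from the stack `k` until it is empty, or, if `brk` is set, until `false` is found,
running `FF` or `FT` for each bit. -/
def Frag.loop (k : K) (dec : Γ k → Bool) (brk : Bool) (FF FT : Frag Γ (Option Bool × τ)) :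
    Frag Γ (Option Bool × τ) where
  Λ := Option (FF.Λ ⊕ FT.Λ)
  fin := @instFintypeOption _ (@instFintypeSum _ _ FF.fin FT.fin)
  entry := none
  code
    | none => popJump k dec .halt
        (if brk then .halt else (.goto fun _ => some (.inl FF.entry)))
        (.goto fun _ => some (.inr FT.entry))
    | some (.inl l) => relabel (fun l => some (.inl l)) (some none) (FF.code l)
    | some (.inr l) => relabel (fun l => some (.inr l)) (some none) (FT.code l)

theorem Frag.runs_loop_nil {k : K} {dec : Γ k → Bool} {brk : Bool}
    {FF FT : Frag Γ (Option Bool × τ)} {w : τ} {S : ∀ k, List (Γ k)} (hk : S k = []) :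
    (Frag.loop k dec brk FF FT).Runs (none, w) S 1 S :=
  ⟨1, le_rfl, Steps.head (congrArg some (stepAux_popJump_nil hk)) (Steps.refl _)⟩

theorem Frag.runs_loop_exit {k : K} {dec : Γ k → Bool}
    {FF FT : Frag Γ (Option Bool × τ)} {w : τ} {S : ∀ k, List (Γ k)} {x : Γ k} {l : List (Γ k)}
    (hk : S k = x :: l) (hx : dec x = false) :
    (Frag.loop k dec true FF FT).Runs (none, w) S 1 (Function.update S k l) := by
  refine ⟨1, le_rfl, Steps.head (congrArg some (stepAux_popJump_cons hk)) ?_⟩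
  rw [hx]
  exact Steps.refl _

theorem Frag.runs_loop_true {k : K} {dec : Γ k → Bool} {brk : Bool}
    {FF FT : Frag Γ (Option Bool × τ)} {w : τ} {S S₁ S₂ : ∀ k, List (Γ k)} {x : Γ k}
    {l : List (Γ k)} {T₁ T₂ : ℕ} (hk : S k = x :: l) (hx : dec x = true)
    (h₁ : FT.Runs (none, w) (Function.update S k l) T₁ S₁)
    (h₂ : (Frag.loop k dec brk FF FT).Runs (none, w) S₁ T₂ S₂) :
    (Frag.loop k dec brk FF FT).Runs (none, w) S (1 + T₁ + T₂) S₂ := by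
  obtain ⟨t₁, ht₁, h₁⟩ := h₁
  obtain ⟨t₂, ht₂, h₂⟩ := h₂
  refine ⟨t₁ + t₂ + 1, by omega, Steps.head (congrArg some (stepAux_popJump_cons hk)) ?_⟩
  rw [hx]
  exact Steps.trans (Steps.relabel (M' := (Frag.loop k dec brk FF FT).code)
      (f := fun l => some (.inr l)) (e := some none) (fun _ => rfl) h₁) h₂

theorem Frag.runs_loop_false {k : K} {dec : Γ k → Bool}
    {FF FT : Frag Γ (Option Bool × τ)} {w : τ} {S S₁ S₂ : ∀ k, List (Γ k)} {x : Γ k}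
    {l : List (Γ k)} {T₁ T₂ : ℕ} (hk : S k = x :: l) (hx : dec x = false)
    (h₁ : FF.Runs (none, w) (Function.update S k l) T₁ S₁)
    (h₂ : (Frag.loop k dec false FF FT).Runs (none, w) S₁ T₂ S₂) :
    (Frag.loop k dec false FF FT).Runs (none, w) S (1 + T₁ + T₂) S₂ := by
  obtain ⟨t₁, ht₁, h₁⟩ := h₁
  obtain ⟨t₂, ht₂, h₂⟩ := h₂
  refine ⟨t₁ + t₂ + 1, by omega, Steps.head (congrArg some (stepAux_popJump_cons hk)) ?_⟩
  rw [hx]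
  exact Steps.trans (Steps.relabel (M' := (Frag.loop k dec false FF FT).code)
      (f := fun l => some (.inl l)) (e := some none) (fun _ => rfl) h₁) h₂

end Fragments

/-! ### Running a machine beside additional stacks. -/

section Lift

variable {K₁ K₂ : Type} [DecidableEq K₁] [DecidableEq K₂] {Γ₁ : K₁ → Type} {Γ₂ : K₂ → Type}
  {Λ τ ρ : Type}

/-- The contents of two families of stacks, taken as one family. -/
def joinStacks (s : ∀ k, List (Γ₁ k)) (r : ∀ k, List (Γ₂ k)) :
    ∀ k, List (Sum.elim Γ₁ Γ₂ k)
  | .inl k => s k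
  | .inr k => r k

theorem update_joinStacks_inl (s : ∀ k, List (Γ₁ k)) (r : ∀ k, List (Γ₂ k)) (k : K₁)
    (l : List (Γ₁ k)) : Function.update (joinStacks s r) (.inl k) l =
      joinStacks (Function.update s k l) r := by
  refine Function.update_eq_iff.2 ⟨(Function.update_self k l s).symm, fun k' hk => ?_⟩
  cases k' with
  | inl k' => exact (Function.update_of_ne (fun h => hk (congrArg _ h)) _ _).symm
  | inr k' => rfl

theorem update_joinStacks_inr (s : ∀ k, List (Γ₁ k)) (r : ∀ k, List (Γ₂ k)) (k : K₂)
    (l : List (Γ₂ k)) : Function.update (joinStacks s r) (.inr k) l =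
      joinStacks s (Function.update r k l) := by
  refine Function.update_eq_iff.2 ⟨(Function.update_self k l r).symm, fun k' hk => ?_⟩
  cases k' with
  | inl k' => rfl
  | inr k' => exact (Function.update_of_ne (fun h => hk (congrArg _ h)) _ _).symm

variable (Γ₁ ρ) in
/-- Let a statement act on the second family of stacks and the second part of the memory. -/
def liftStmt : TM2.Stmt Γ₂ Λ τ → TM2.Stmt (Sum.elim Γ₁ Γ₂) Λ (ρ × τ)
  | .push k g q => .push (.inr k) (fun v => g v.2) (liftStmt q)
  | .peek k g q => .peek (.inr k) (fun v o => (v.1, g v.2 o)) (liftStmt q)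
  | .pop k g q => .pop (.inr k) (fun v o => (v.1, g v.2 o)) (liftStmt q)
  | .load g q => .load (fun v => (v.1, g v.2)) (liftStmt q)
  | .branch g q₁ q₂ => .branch (fun v => g v.2) (liftStmt q₁) (liftStmt q₂)
  | .goto l => .goto fun v => l v.2
  | .halt => .halt

/-- The configuration of a lifted program. -/
def liftCfg (u : ρ) (s : ∀ k, List (Γ₁ k)) (c : TM2.Cfg Γ₂ Λ τ) :
    TM2.Cfg (Sum.elim Γ₁ Γ₂) Λ (ρ × τ) :=
  ⟨c.l, (u, c.var), joinStacks s c.stk⟩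

theorem stepAux_liftStmt (u : ρ) (s : ∀ k, List (Γ₁ k)) (q : TM2.Stmt Γ₂ Λ τ) (v : τ)
    (r : ∀ k, List (Γ₂ k)) :
    TM2.stepAux (liftStmt Γ₁ ρ q) (u, v) (joinStacks s r) =
      liftCfg u s (TM2.stepAux q v r) := by
  induction q generalizing v r with
  | push k g q ih =>
    simp only [liftStmt, TM2.stepAux]
    rw [← ih, ← update_joinStacks_inr]; rfl
  | peek k g q ih =>
    simp only [liftStmt, TM2.stepAux]
    rw [← ih]; rfl
  | pop k g q ih =>
    simp only [liftStmt, TM2.stepAux]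
    rw [← ih, ← update_joinStacks_inr]; rfl
  | load g q ih => simp only [liftStmt, TM2.stepAux]; rw [← ih]
  | branch g q₁ q₂ h₁ h₂ => cases hg : g v <;> simp [liftStmt, hg, h₁, h₂]
  | goto l => rfl
  | halt => rfl

/-- The extra stacks `s` and the extra memory `u` stay frozen, and the number of steps is unchanged.
-/
theorem Steps.lift {M : Λ → TM2.Stmt Γ₂ Λ τ} {t : ℕ} {c c' : TM2.Cfg Γ₂ Λ τ}
    (h : Steps M t c c') (u : ρ) (s : ∀ k, List (Γ₁ k)) :
    Steps (fun l => liftStmt Γ₁ ρ (M l)) t (liftCfg u s c) (liftCfg u s c') := by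
  induction h with
  | refl c => exact Steps.refl _
  | @head t c c₁ c₂ h _ ih =>
    refine Steps.head ?_ ih
    obtain ⟨l, v, r⟩ := c
    cases l with
    | none => simp at h
    | some l =>
      simp only [TM2.step, Option.some.injEq] at h
      subst h
      exact congrArg some (stepAux_liftStmt u s (M l) v r)

end Lift

/-! ### Elementary programs on bit stacks, with running times. -/

/-- The stacks of the reduction. -/
inductive Reg
  | inp | num | num' | dum | blk | blk' | out | col | row | low | cnt | cnt' | idx | tmp | flag | res
  deriving DecidableEq

/-- All stacks. -/
def Reg.list : List Reg :=
  [inp, num, num', dum, blk, blk', out, col, row, low, cnt, cnt', idx, tmp, flag, res]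

theorem Reg.mem_list (x : Reg) : x ∈ Reg.list := by
  cases x <;> simp [Reg.list]

instance : Fintype Reg := Fintype.ofList Reg.list Reg.mem_list

/-- The contents of these stacks. -/
abbrev RegFile := Reg → List Bool

section Programs

variable {K₂ : Type} [DecidableEq K₂]

/-- Programs on the stacks `Reg`, possibly accompanied by other stacks. -/
abbrev Prog (Γ₂ : K₂ → Type) (τ : Type) :=
  Frag (Sum.elim (fun _ : Reg => Bool) Γ₂) (Option Bool × τ)

variable {Γ₂ : K₂ → Type} {τ : Type}

/-- The program `P` turns the contents `s` into `s'` in time `T`, touching no other stacks. -/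
def Does (P : Prog Γ₂ τ) (s : RegFile) (T : ℕ) (s' : RegFile) : Prop :=
  ∀ (w : τ) (r : ∀ k, List (Γ₂ k)), Frag.Runs P (none, w) (joinStacks s r) T (joinStacks s' r)

infixr:60 " ;; " => Frag.seq

theorem Does.mono {P : Prog Γ₂ τ} {s s' s'' : RegFile} {T T' : ℕ} (h : Does P s T s')
    (hT : T ≤ T') (hs : s' = s'') : Does P s T' s'' :=
  fun w r => (h w r).mono hT (by rw [hs])

theorem Does.seq {P Q : Prog Γ₂ τ} {s s₁ s₂ : RegFile} {T₁ T₂ : ℕ} (h₁ : Does P s T₁ s₁)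
    (h₂ : Does Q s₁ T₂ s₂) : Does (P ;; Q) s (T₁ + T₂) s₂ :=
  fun w r => (h₁ w r).seq (h₂ w r)

/-- Push a bit. -/
def push (k : Reg) (b : Bool) : Prog Γ₂ τ := Frag.push (Γ := Sum.elim _ Γ₂) (.inl k) b

/-- Pop a bit and branch. -/
def popCase (k : Reg) (PN PF PT : Prog Γ₂ τ) : Prog Γ₂ τ :=
  Frag.popCase (Γ := Sum.elim _ Γ₂) (.inl k) id PN PF PT

/-- Pop the bits of `k` one by one, running `PF` or `PT` for each of them. -/
def forEach (k : Reg) (PF PT : Prog Γ₂ τ) : Prog Γ₂ τ :=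
  Frag.loop (Γ := Sum.elim _ Γ₂) (.inl k) id false PF PT

theorem does_skip (s : RegFile) : Does (Frag.skip : Prog Γ₂ τ) s 1 s :=
  fun _ _ => Frag.runs_skip _ _

theorem does_push {k : Reg} {b : Bool} {s : RegFile} {l : List Bool} (h : s k = l) :
    Does (push k b : Prog Γ₂ τ) s 1 (Function.update s k (b :: l)) := by
  intro w r
  rw [← update_joinStacks_inl, ← h]
  exact Frag.runs_push (Γ := Sum.elim (fun _ : Reg => Bool) Γ₂) (.inl k) b _ (joinStacks s r)

theorem does_popCase_nil {k : Reg} {PN PF PT : Prog Γ₂ τ} {s s' : RegFile} {T : ℕ}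
    (hk : s k = []) (h : Does PN s T s') : Does (popCase k PN PF PT) s (T + 1) s' :=
  fun w r => Frag.runs_popCase_nil (S := joinStacks s r) hk (h w r)

theorem does_popCase_false {k : Reg} {PN PF PT : Prog Γ₂ τ} {s s' : RegFile} {T : ℕ}
    {l : List Bool} (hk : s k = false :: l) (h : Does PF (Function.update s k l) T s') :
    Does (popCase k PN PF PT) s (T + 1) s' :=
  fun w r => Frag.runs_popCase_false (S := joinStacks s r) (x := false) (l := l) hk rfl
    (by rw [update_joinStacks_inl]; exact h w r)

theorem does_popCase_true {k : Reg} {PN PF PT : Prog Γ₂ τ} {s s' : RegFile} {T : ℕ}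
    {l : List Bool} (hk : s k = true :: l) (h : Does PT (Function.update s k l) T s') :
    Does (popCase k PN PF PT) s (T + 1) s' :=
  fun w r => Frag.runs_popCase_true (S := joinStacks s r) (x := true) (l := l) hk rfl
    (by rw [update_joinStacks_inl]; exact h w r)

theorem does_forEach_nil {k : Reg} {PF PT : Prog Γ₂ τ} {s : RegFile} (hk : s k = []) :
    Does (forEach k PF PT) s 1 s :=
  fun _ r => Frag.runs_loop_nil (S := joinStacks s r) hk

theorem does_forEach_cons {k : Reg} {PF PT : Prog Γ₂ τ} {s s₁ s₂ : RegFile} {T₁ T₂ : ℕ} {b : Bool}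
    {l : List Bool} (hk : s k = b :: l)
    (h₁ : Does (if b then PT else PF) (Function.update s k l) T₁ s₁)
    (h₂ : Does (forEach k PF PT) s₁ T₂ s₂) : Does (forEach k PF PT) s (1 + T₁ + T₂) s₂ := by
  intro w r
  cases b with
  | false =>
    exact Frag.runs_loop_false (Γ := Sum.elim _ Γ₂) (k := .inl k) (S := joinStacks s r) (x := false) (l := l) hk rfl
      (by rw [update_joinStacks_inl]; exact h₁ w r) (h₂ w r)
  | true =>
    exact Frag.runs_loop_true (Γ := Sum.elim _ Γ₂) (k := .inl k) (S := joinStacks s r) (x := true) (l := l) hk rfl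
      (by rw [update_joinStacks_inl]; exact h₁ w r) (h₂ w r)

/-- The rule for counting loops. -/
theorem does_forEach_replicate {k : Reg} {PF PT : Prog Γ₂ τ} {m T : ℕ} (f : ℕ → RegFile)
    (hk : ∀ i ≤ m, f i k = List.replicate (m - i) true)
    (hf : ∀ i < m, Does PT (Function.update (f i) k (List.replicate (m - i - 1) true)) T
      (f (i + 1))) :
    Does (forEach k PF PT) (f 0) (m * (T + 1) + 1) (f m) := by
  -- Induction on the number `j` of rounds still to come, because the loop is unfolded at its front.
  have key : ∀ j ≤ m, Does (forEach k PF PT) (f (m - j)) (j * (T + 1) + 1) (f m) := by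
    intro j
    induction j with
    | zero => exact fun _ => (does_forEach_nil (by simpa using hk m le_rfl)).mono (by omega) rfl
    | succ j ih =>
      intro hj
      have h := hf (m - (j + 1)) (by omega)
      rw [show m - (j + 1) + 1 = m - j by omega] at h
      refine (does_forEach_cons (b := true) (l := List.replicate (m - (m - (j + 1)) - 1) true)
        ?_ h (ih (by omega))).mono (by ring_nf; omega) rfl
      rw [hk _ (by omega), ← List.replicate_succ]
      congr 1
      omega
  simpa using key m le_rfl

/-- Move the contents of `x` to `y`, in reversed order. -/
def move (x y : Reg) : Prog Γ₂ τ := forEach x (push y false) (push y true)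

theorem does_move {x y : Reg} (hxy : x ≠ y) {s : RegFile} {lx ly : List Bool} (hx : s x = lx)
    (hy : s y = ly) : Does (move x y : Prog Γ₂ τ) s (2 * lx.length + 1)
      (Function.update (Function.update s x []) y (lx.reverse ++ ly)) := by
  induction lx generalizing s ly with
  | nil =>
    refine (does_forEach_nil hx).mono (by simp) ?_
    have : Function.update s x [] = s := by rw [← hx, Function.update_eq_self]
    subst hy
    simp [this]
  | cons b l ih =>
    have h1 : Does (if b then push y true else push y false : Prog Γ₂ τ)
        (Function.update s x l) 1 (Function.update (Function.update s x l) y (b :: ly)) := by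
      cases b <;> exact does_push (by simp [hxy.symm, hy])
    refine (does_forEach_cons hx h1 (ih (ly := b :: ly) ?_ ?_)).mono (by simp; omega) ?_
    · simp [hxy]
    · simp
    · rw [Function.update_comm hxy.symm]
      simp

/-- Move the contents of `x` to both `y` and `z`, in reversed order. -/
def moveBoth (x y z : Reg) : Prog Γ₂ τ :=
  forEach x (push y false ;; push z false) (push y true ;; push z true)

theorem does_moveBoth {x y z : Reg} (hxy : x ≠ y) (hxz : x ≠ z) (hyz : y ≠ z) {s : RegFile}
    {lx ly lz : List Bool} (hx : s x = lx) (hy : s y = ly) (hz : s z = lz) :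
    Does (moveBoth x y z : Prog Γ₂ τ) s (3 * lx.length + 1)
      (Function.update (Function.update (Function.update s x []) y (lx.reverse ++ ly)) z
        (lx.reverse ++ lz)) := by
  induction lx generalizing s ly lz with
  | nil =>
    refine (does_forEach_nil hx).mono (by simp) ?_
    have : Function.update s x [] = s := by rw [← hx, Function.update_eq_self]
    subst hy hz
    simp [this]
  | cons b l ih =>
    have h1 : Does (if b then (push y true ;; push z true) else (push y false ;; push z false) :
        Prog Γ₂ τ) (Function.update s x l) (1 + 1) (Function.update (Function.update
          (Function.update s x l) y (b :: ly)) z (b :: lz)) := by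
      cases b <;>
        exact (does_push (by simp [hxy.symm, hy])).seq
          (does_push (by simp [hxz.symm, hyz.symm, hz]))
    refine (does_forEach_cons hx h1 (ih (ly := b :: ly) (lz := b :: lz) ?_ ?_ ?_)).mono
      (by simp; omega) ?_
    · simp [hxy, hxz]
    · simp [hyz]
    · simp
    · funext k
      by_cases h1 : k = z
      · subst h1; simp
      by_cases h2 : k = y
      · subst h2; simp [hyz]
      by_cases h3 : k = x
      · subst h3; simp [hxy, hxz]
      simp [h1, h2, h3]

/-- Put a copy of the contents of `x` on top of `y`, with the help of the empty stack `t`. -/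
def copy (x y t : Reg) : Prog Γ₂ τ := move x t ;; moveBoth t x y

/-- The two moves reverse the contents twice, so `x` is restored and `y` gets the original order. -/
theorem does_copy {x y t : Reg} (hxy : x ≠ y) (hxt : x ≠ t) (hyt : y ≠ t) {s : RegFile}
    {lx ly : List Bool} (hx : s x = lx) (hy : s y = ly) (ht : s t = []) :
    Does (copy x y t : Prog Γ₂ τ) s (5 * lx.length + 2) (Function.update s y (lx ++ ly)) := by
  refine ((does_move hxt hx ht).seq (does_moveBoth (lx := lx.reverse) (ly := []) (lz := ly)
    hxt.symm hyt.symm hxy ?_ ?_ ?_)).mono (by simp; omega) ?_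
  · simp
  · simp [hxt]
  · simp [hyt, hxy.symm, hy]
  · funext k
    by_cases h1 : k = y
    · subst h1; simp
    by_cases h2 : k = x
    · subst h2; simp [hxy, hx]
    by_cases h3 : k = t
    · subst h3; simp [h1, h2, ht]
    simp [h1, h2, h3]

/-- Empty the stack `x`. -/
def clear (x : Reg) : Prog Γ₂ τ := forEach x Frag.skip Frag.skip

theorem does_clear {x : Reg} {s : RegFile} {l : List Bool} (hx : s x = l) :
    Does (clear x : Prog Γ₂ τ) s (2 * l.length + 1) (Function.update s x []) := by
  induction l generalizing s with
  | nil =>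
    refine (does_forEach_nil hx).mono (by simp) ?_
    rw [← hx, Function.update_eq_self]
  | cons b l ih =>
    refine (does_forEach_cons hx (s₁ := Function.update s x l) (T₁ := 1) ?_ (ih ?_)).mono
      (by simp; omega) ?_
    · cases b <;> exact does_skip _
    · simp
    · simp

/-- Empty all stacks of a list. -/
def clearList : List Reg → Prog Γ₂ τ
  | [] => Frag.skip
  | x :: l => clear x ;; clearList l

theorem does_clearList {L : ℕ} (l : List Reg) {s : RegFile} (hs : ∀ x, (s x).length ≤ L) :
    Does (clearList l : Prog Γ₂ τ) s (l.length * (2 * L + 1) + 1)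
      (fun x => if x ∈ l then [] else s x) := by
  induction l generalizing s with
  | nil => exact (does_skip s).mono (by simp) (by simp)
  | cons x l ih =>
    have h := hs x
    refine ((does_clear rfl).seq (ih (s := Function.update s x []) ?_)).mono
      (by simp only [List.length_cons]; ring_nf; omega) ?_
    · intro y
      by_cases hy : y = x
      · subst hy; simp
      · simp [hy, hs]
    · funext y
      by_cases hy : y = x
      · subst hy; simp
      · simp [hy]

/-- Read a number from the input. -/
def readNum (x : Reg) : Prog Γ₂ τ :=
  Frag.loop (Γ := Sum.elim _ Γ₂) (.inl Reg.inp) id true Frag.skip (push x true)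

theorem does_readNum {x : Reg} (hx : .inp ≠ x) {s : RegFile} {k : ℕ} {l lx : List Bool}
    (hi : s .inp = encodeNum k ++ l) (hs : s x = lx) :
    Does (readNum x : Prog Γ₂ τ) s (2 * k + 1)
      (Function.update (Function.update s .inp l) x (List.replicate k true ++ lx)) := by
  induction k generalizing s lx with
  | zero =>
    intro w r
    refine (Frag.runs_loop_exit (Γ := Sum.elim _ Γ₂) (k := .inl Reg.inp) (dec := id)
      (S := joinStacks s r) (x := false) (l := l) hi rfl).mono (Nat.le_add_left _ _) ?_
    rw [update_joinStacks_inl]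
    congr 1
    subst hs
    simp [hx.symm]
  | succ k ih =>
    intro w r
    have h1 : Does (push x true : Prog Γ₂ τ)
        (Function.update s .inp (encodeNum k ++ l)) 1
        (Function.update (Function.update s .inp (encodeNum k ++ l)) x (true :: lx)) :=
      does_push (by simp [hx.symm, hs])
    have h2 := ih (s := Function.update (Function.update s .inp (encodeNum k ++ l)) x (true :: lx))
      (lx := true :: lx) (by simp [hx]) (by simp)
    refine (Frag.runs_loop_true (Γ := Sum.elim _ Γ₂) (k := .inl Reg.inp) (S := joinStacks s r) (x := true) (l := encodeNum k ++ l) hi rfl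
      (by rw [update_joinStacks_inl]; exact h1 w r) (h2 w r)).mono (by omega) ?_
    congr 1
    rw [Function.update_comm hx.symm]
    simp [List.replicate_succ']

end Programs

/-! ### Unary arithmetic and the blocks of dummies. -/

/-- The number `k` in unary. -/
abbrev ones (k : ℕ) : List Bool := List.replicate k true

/-- The code of a list of numbers. -/
def encodeNums (L : List ℕ) : List Bool := L.flatMap encodeNum

theorem encodeNums_append (L L' : List ℕ) : encodeNums (L ++ L') = encodeNums L ++ encodeNums L' :=
  List.flatMap_append

theorem encodeNums_singleton (k : ℕ) : encodeNums [k] = encodeNum k := by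
  simp [encodeNums]

theorem encodeNum_reverse (k : ℕ) : (encodeNum k).reverse = false :: ones k := by
  simp [encodeNum]

theorem length_encodeNum (k : ℕ) : (encodeNum k).length = k + 1 := by
  simp [encodeNum]

theorem length_encodeNums_le {L : List ℕ} {m : ℕ} (h : ∀ x ∈ L, x < m) :
    (encodeNums L).length ≤ L.length * m := by
  induction L with
  | nil => simp [encodeNums]
  | cons a L ih =>
    have h1 := ih fun x hx => h x (by simp [hx])
    have h2 := h a (by simp)
    rw [show a :: L = [a] ++ L from rfl, encodeNums_append, encodeNums_singleton, List.length_append,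
      length_encodeNum, List.length_append, Nat.add_mul]
    simp only [List.length_singleton]
    omega

section Programs

variable {K₂ : Type} [DecidableEq K₂] {Γ₂ : K₂ → Type} {τ : Type}

/-- Multiply the contents of `dum` by `num + 2`. -/
def mulStep : Prog Γ₂ τ :=
  forEach .dum Frag.skip (copy .num .low .tmp ;; push .low true ;; push .low true) ;;
    move .low .dum

theorem does_mulStep {s : RegFile} {n a : ℕ} (hn : s .num = ones n) (hd : s .dum = ones a)
    (hl : s .low = []) (ht : s .tmp = []) :
    Does (mulStep : Prog Γ₂ τ) s (a * (7 * n + 9) + 2)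
      (Function.update s .dum (ones (a * (n + 2)))) := by
  -- Loop invariant: after `i` rounds `low` holds `i * (n + 2)`.
  let f : ℕ → RegFile := fun i =>
    Function.update (Function.update s .dum (ones (a - i))) .low (ones (i * (n + 2)))
  have h := does_forEach_replicate (Γ₂ := Γ₂) (τ := τ) (k := .dum) (m := a) (PF := Frag.skip)
    (PT := copy .num .low .tmp ;; push .low true ;; push .low true) (T := 5 * n + 4) f
    (fun i _ => by simp [f]) (fun i hi => by
      refine ((does_copy (lx := ones n) (ly := ones (i * (n + 2))) (by simp) (by simp) (by simp)
        ?_ ?_ ?_).seq ((does_push rfl).seq (does_push rfl))).mono (by simp) ?_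
      · simp [f, hn]
      · simp [f]
      · simp [f, ht]
      · funext x
        cases x <;> simp [f, Nat.sub_sub]
        rw [← List.replicate_succ, ← List.replicate_succ]
        congr 1; ring)
  have h0 : f 0 = s := by
    funext x; cases x <;> simp [f, hd, hl]
  rw [h0] at h
  refine (h.seq (does_move (lx := ones (a * (n + 2))) (ly := []) (by simp) ?_ ?_)).mono ?_ ?_
  · simp [f]
  · simp [f]
  · simp; ring_nf; omega
  · funext x; cases x <;> simp [f, hl]

/-- Write `(num + 2) ^ q` to `dum`. -/
def powProg : ℕ → Prog Γ₂ τ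
  | 0 => push .dum true
  | q + 1 => powProg q ;; mulStep

/-- The running time of `powProg`. -/
def powTime (n : ℕ) : ℕ → ℕ
  | 0 => 1
  | q + 1 => powTime n q + ((n + 2) ^ q * (7 * n + 9) + 2)

theorem does_powProg (q : ℕ) {s : RegFile} {n : ℕ} (hn : s .num = ones n) (hd : s .dum = [])
    (hl : s .low = []) (ht : s .tmp = []) :
    Does (powProg q : Prog Γ₂ τ) s (powTime n q) (Function.update s .dum (ones ((n + 2) ^ q))) := by
  induction q with
  | zero => exact (does_push hd).mono le_rfl (by simp)
  | succ q ih =>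
    refine (ih.seq (does_mulStep (n := n) (a := (n + 2) ^ q) ?_ ?_ ?_ ?_)).mono le_rfl ?_
    · simp [hn]
    · simp
    · simp [hl]
    · simp [ht]
    · simp [pow_succ]

/-- Write to `b` the names of as many candidates as `dum` says, and advance `col` by this number. -/
def blockProg (b : Reg) : Prog Γ₂ τ :=
  copy .dum .cnt .tmp ;; forEach .cnt Frag.skip (copy .col b .tmp ;; push b false ;; push .col true)

theorem does_blockProg {b : Reg} (hb : b = .blk ∨ b = .blk') {s : RegFile} {D x : ℕ}
    (hD : s .dum = ones D) (hx : s .col = ones x) (hs : s b = []) (hc : s .cnt = [])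
    (ht : s .tmp = []) :
    Does (blockProg b : Prog Γ₂ τ) s (5 * D + 2 + (D * (5 * (x + D) + 5) + 1))
      (Function.update (Function.update s b (encodeNums (List.range' x D)).reverse) .col
        (ones (x + D))) := by
  -- Loop invariant after `i` names. The code is stored reversed, since `out` has the end of the
  -- output on top and blocks are copied there unchanged.
  let f : ℕ → RegFile := fun i =>
    Function.update (Function.update (Function.update s b
      (encodeNums (List.range' x i)).reverse) .col (ones (x + i))) .cnt (ones (D - i))
  have h := does_forEach_replicate (Γ₂ := Γ₂) (τ := τ) (k := .cnt) (m := D) (PF := Frag.skip)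
    (PT := copy .col b .tmp ;; push b false ;; push .col true) (T := 5 * (x + D) + 4) f
    (fun i _ => by simp [f]) (fun i hi => by
      refine ((does_copy (lx := ones (x + i)) (ly := (encodeNums (List.range' x i)).reverse)
        ?_ (by simp) ?_ ?_ ?_ ?_).seq ((does_push rfl).seq (does_push rfl))).mono ?_ ?_
      · rcases hb with rfl | rfl <;> simp
      · rcases hb with rfl | rfl <;> simp
      · simp [f]
      · rcases hb with rfl | rfl <;> simp [f]
      · rcases hb with rfl | rfl <;> simp [f, ht]
      · simp; omega
      · have he : (encodeNums (List.range' x (i + 1))).reverse =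
            false :: (ones (x + i) ++ (encodeNums (List.range' x i)).reverse) := by
          rw [List.range'_concat, encodeNums_append, encodeNums_singleton, List.reverse_append,
            one_mul, encodeNum_reverse]
          rfl
        have ho : ones (x + (i + 1)) = true :: ones (x + i) := rfl
        rcases hb with rfl | rfl <;> funext y <;> cases y <;>
          simp [f, Nat.sub_sub] <;>
          simp [he, ho])
  have h0 : f 0 = Function.update s .cnt (ones D) := by
    rcases hb with rfl | rfl <;>
    · funext y; cases y <;> simp [f, hs, hx, encodeNums]
  rw [h0] at h
  refine ((does_copy (lx := ones D) (ly := []) (by simp) (by simp) (by simp) hD hc ht).seq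
    (by simpa using h)).mono ?_ ?_
  · simp
  · rcases hb with rfl | rfl <;>
    · funext y; cases y <;> simp [f, hc]

/-- Write the code of the unary number in `x` to `out`. -/
def writeNum (x : Reg) : Prog Γ₂ τ := copy x .out .tmp ;; push .out false

theorem does_writeNum {x : Reg} (hx : x ≠ .out) (hx' : x ≠ .tmp) {s : RegFile} {k : ℕ}
    {o : List Bool} (hk : s x = ones k) (ho : s .out = o.reverse) (ht : s .tmp = []) :
    Does (writeNum x : Prog Γ₂ τ) s (5 * k + 3)
      (Function.update s .out (o ++ encodeNum k).reverse) := by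
  refine ((does_copy hx hx' (by simp) hk ho ht).seq (does_push rfl)).mono (by simp) ?_
  rw [List.reverse_append, encodeNum_reverse]
  simp

end Programs

/-! ### From adjacency matrices to votes. -/

section Programs

variable {K₂ : Type} [DecidableEq K₂] {Γ₂ : K₂ → Type} {τ : Type}

theorem does_copy_reverse_out {x : Reg} (hx : x ≠ .out) (hx' : x ≠ .tmp) {s : RegFile}
    {l o : List Bool} (hl : s x = l.reverse) (ho : s .out = o.reverse) (ht : s .tmp = []) :
    Does (copy x .out .tmp : Prog Γ₂ τ) s (5 * l.length + 2)
      (Function.update s .out (o ++ l).reverse) :=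
  (does_copy hx hx' (by simp) hl ho ht).mono (by simp) (by simp)

/-- Read the next bit of an adjacency matrix, and write the vertex `col` accordingly. -/
def vertexProg : Prog Γ₂ τ :=
  popCase .inp Frag.skip (push .low false ;; copy .col .low .tmp) (writeNum .col)

/-- Treat the next entry of a row of an adjacency matrix. -/
def cellProg : Prog Γ₂ τ :=
  popCase .idx vertexProg (popCase .inp Frag.skip Frag.skip Frag.skip) vertexProg ;; push .col true

/-- A neighbour is written to `out` at once; a non-neighbour waits on `low` until the second block
of dummies has been written. -/
theorem does_vertexProg {s : RegFile} {t : ℕ} {b : Bool} {l o z : List Bool}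
    (hi : s .inp = b :: l) (hc : s .col = ones t) (ho : s .out = o.reverse) (hz : s .low = z)
    (ht : s .tmp = []) :
    Does (vertexProg : Prog Γ₂ τ) s (5 * t + 4)
      (Function.update (Function.update (Function.update s .inp l) .out
        (o ++ if b then encodeNum t else []).reverse) .low
        ((if b then [] else encodeNum t) ++ z)) := by
  cases b with
  | false =>
    refine (does_popCase_false hi ((does_push (l := z) ?_).seq
      (does_copy (lx := ones t) (ly := false :: z) (by simp) (by simp) (by simp) ?_ ?_ ?_))).mono
      ?_ ?_
    · simp [hz]
    · simp [hc]
    · simp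
    · simp [ht]
    · simp; omega
    · funext x; cases x <;> simp [encodeNum, ho]
  | true =>
    refine (does_popCase_true hi (does_writeNum (k := t) (o := o) (by simp) (by simp)
      ?_ ?_ ?_)).mono ?_ ?_
    · simp [hc]
    · simp [ho]
    · simp [ht]
    · simp
    · funext x; cases x <;> simp [hz]

/-- The stack `idx` detects the diagonal: it yields `true` in the columns before `i`, `false` in
column `i`, and is empty afterwards. The diagonal entry is read and dropped. -/
theorem does_cellProg {s : RegFile} {t i : ℕ} {b : Bool} {l o z : List Bool}
    (hidx : s .idx = (ones i ++ [false]).drop t)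
    (hi : s .inp = b :: l) (hc : s .col = ones t) (ho : s .out = o.reverse) (hz : s .low = z)
    (ht : s .tmp = []) :
    Does (cellProg : Prog Γ₂ τ) s (5 * t + 6)
      (Function.update (Function.update (Function.update (Function.update (Function.update s
        .idx ((ones i ++ [false]).drop (t + 1))) .inp l) .out
        (o ++ if t ≠ i && b then encodeNum t else []).reverse) .low
        ((if t ≠ i && !b then encodeNum t else []) ++ z)) .col (ones (t + 1))) := by
  rcases lt_trichotomy t i with h | rfl | h
  · have hd : (ones i ++ [false]).drop t = true :: (ones i ++ [false]).drop (t + 1) := by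
      rw [List.drop_eq_getElem_cons (by simp; omega)]
      simp [h]
    rw [hd] at hidx
    refine ((does_popCase_true hidx (does_vertexProg (t := t) (b := b) (l := l) (o := o) (z := z)
      ?_ ?_ ?_ ?_ ?_)).seq (does_push (l := ones t) ?_)).mono (by omega) ?_
    · simp [hi]
    · simp [hc]
    · simp [ho]
    · simp [hz]
    · simp [ht]
    · simp [hc]
    · funext x; cases x <;> cases b <;> simp [h.ne, List.replicate_succ]
  · have hd : (ones t ++ [false]).drop t = false :: (ones t ++ [false]).drop (t + 1) := by
      simp
    rw [hd] at hidx
    refine ((does_popCase_false hidx (T := 2) (s' := Function.update (Function.update s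
      .idx ((ones t ++ [false]).drop (t + 1))) .inp l) ?_).seq
      (does_push (l := ones t) ?_)).mono (by omega) ?_
    · cases b with
      | false => exact does_popCase_false (l := l) (by simp [hi]) (does_skip _)
      | true => exact does_popCase_true (l := l) (by simp [hi]) (does_skip _)
    · simp [hc]
    · funext x; cases x <;> simp [ho, hz, List.replicate_succ]
  · have hd : ∀ k, t ≤ k → (ones i ++ [false]).drop k = [] := by
      intro k hk
      simp; omega
    rw [hd t le_rfl] at hidx
    refine ((does_popCase_nil hidx (does_vertexProg (t := t) (b := b) (l := l) (o := o) (z := z)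
      hi hc ho hz ht)).seq (does_push (l := ones t) ?_)).mono (by omega) ?_
    · simp [hc]
    · rw [hd (t + 1) (by omega)]
      funext x; cases x <;> cases b <;> simp [h.ne', List.replicate_succ, hidx]

/-- Read a row of an adjacency matrix, and write the vote of its vertex. -/
def rowProg : Prog Γ₂ τ :=
  writeNum .row ;; copy .blk .out .tmp ;; push .idx false ;; copy .row .idx .tmp ;;
    copy .num .cnt' .tmp ;; forEach .cnt' Frag.skip cellProg ;; copy .blk' .out .tmp ;;
    move .low .out ;; clear .col ;; push .row true

/-- A bound on the running time of `rowProg`. -/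
def rowTime (n D : ℕ) : ℕ := 10 * (D * (n + 2 * D)) + 7 * (n * n) + 24 * n + 20

theorem topVertices_succ (t i : ℕ) (a : ℕ → Bool) :
    topVertices (t + 1) i a = topVertices t i a ++ if t ≠ i && a t then [t] else [] := by
  rw [topVertices, List.range_succ, List.filter_append]
  simp [topVertices, List.filter_cons]

theorem bottomVertices_succ (t i : ℕ) (a : ℕ → Bool) :
    bottomVertices (t + 1) i a = bottomVertices t i a ++ if t ≠ i && !a t then [t] else [] := by
  rw [bottomVertices, List.range_succ, List.filter_append]
  simp [bottomVertices, List.filter_cons]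

theorem does_row_cells {s : RegFile} {n i : ℕ} {a : ℕ → Bool} {rest o : List Bool}
    (hidx : s .idx = ones i ++ [false]) (hi : s .inp = (List.range n).map a ++ rest)
    (hcol : s .col = []) (ho : s .out = o.reverse) (hz : s .low = []) (ht : s .tmp = [])
    (hcnt : s .cnt' = ones n) :
    Does (forEach .cnt' Frag.skip cellProg : Prog Γ₂ τ) s (n * (5 * n + 7) + 1)
      (Function.update (Function.update (Function.update (Function.update (Function.update
        (Function.update s .cnt' []) .idx ((ones i ++ [false]).drop n)) .inp rest) .out
        (o ++ encodeNums (topVertices n i a)).reverse) .low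
        (encodeNums (bottomVertices n i a).reverse)) .col (ones n)) := by
  -- Loop invariant: after `t` columns, the vertices below `t` have been distributed to `out` and
  -- `low`.
  let f : ℕ → RegFile := fun t =>
    (Function.update (Function.update (Function.update (Function.update (Function.update
        (Function.update s .cnt' (ones (n - t))) .idx ((ones i ++ [false]).drop t)) .inp
        ((List.range' t (n - t)).map a ++ rest)) .out
        (o ++ encodeNums (topVertices t i a)).reverse) .low
        (encodeNums (bottomVertices t i a).reverse)) .col (ones t))
  have h := does_forEach_replicate (Γ₂ := Γ₂) (τ := τ) (k := .cnt') (m := n) (PF := Frag.skip)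
    (PT := cellProg) (T := 5 * n + 6) f
    (fun t _ => by simp [f]) (fun t htn => by
      refine (does_cellProg (t := t) (i := i) (b := a t)
        (l := (List.range' (t + 1) (n - (t + 1))).map a ++ rest)
        (o := o ++ encodeNums (topVertices t i a))
        (z := encodeNums (bottomVertices t i a).reverse) ?_ ?_ ?_ ?_ ?_ ?_).mono (by omega) ?_
      · simp [f]
      · have : n - t = (n - (t + 1)) + 1 := by omega
        simp [f, this, List.range'_succ]
      · simp [f]
      · simp [f]
      · simp [f]
      · simp [f, ht]
      · funext x
        cases x
        case out =>
          simp only [f]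
          rw [topVertices_succ]
          split_ifs <;> simp [encodeNums]
        case low =>
          simp only [f]
          rw [bottomVertices_succ]
          split_ifs <;> simp [encodeNums]
        all_goals simp [f, Nat.sub_sub])
  have h0 : f 0 = s := by
    funext x
    cases x <;> simp [f, hidx, hi, hcol, ho, hz, hcnt, topVertices, bottomVertices, encodeNums,
      List.range_eq_range']
  rw [h0] at h
  refine h.mono le_rfl ?_
  simp [f]

theorem does_rowProg {s : RegFile} {n D i : ℕ} {a : ℕ → Bool} {rest o : List Bool} (hin : i < n)
    (hn : s .num = ones n) (hrow : s .row = ones i)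
    (hb : s .blk = (encodeNums (List.range' n D)).reverse)
    (hb' : s .blk' = (encodeNums (List.range' (n + D) D)).reverse)
    (hi : s .inp = (List.range n).map a ++ rest) (ho : s .out = o.reverse)
    (hcol : s .col = []) (hz : s .low = []) (hcnt : s .cnt' = []) (hidx : s .idx = [])
    (ht : s .tmp = []) :
    Does (rowProg : Prog Γ₂ τ) s (rowTime n D)
      (Function.update (Function.update (Function.update s .inp rest) .row (ones (i + 1))) .out
        (o ++ encodeNums (voteList n D i a)).reverse) := by
  have hl1 : (encodeNums (List.range' n D)).length ≤ D * (n + 2 * D) := by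
    simpa using length_encodeNums_le (L := List.range' n D) (m := n + 2 * D) (by simp; omega)
  have hl2 : (encodeNums (List.range' (n + D) D)).length ≤ D * (n + 2 * D) := by
    simpa using length_encodeNums_le (L := List.range' (n + D) D) (m := n + 2 * D) (by simp; omega)
  have hl3 : (encodeNums (bottomVertices n i a).reverse).length ≤ n * n := by
    refine (length_encodeNums_le (m := n) ?_).trans (Nat.mul_le_mul_right _ ?_)
    · simp only [List.mem_reverse, mem_bottomVertices]
      exact fun x hx => hx.1
    · rw [List.length_reverse]
      exact (List.length_filter_le _ _).trans_eq List.length_range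
  refine ((does_writeNum (k := i) (o := o) (by simp) (by simp) hrow ho ht).seq <|
    (does_copy_reverse_out (l := encodeNums (List.range' n D)) (o := o ++ encodeNum i)
      (by simp) (by simp) (by simp [hb]) (by simp) (by simp [ht])).seq <|
    (does_push (l := []) (by simp [hidx])).seq <|
    (does_copy (lx := ones i) (ly := [false]) (by simp) (by simp) (by simp)
      (by simp [hrow]) (by simp) (by simp [ht])).seq <|
    (does_copy (lx := ones n) (ly := []) (by simp) (by simp) (by simp)
      (by simp [hn]) (by simp [hcnt]) (by simp [ht])).seq <|
    (does_row_cells (n := n) (i := i) (a := a) (rest := rest)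
      (o := o ++ encodeNum i ++ encodeNums (List.range' n D)) (by simp) (by simp [hi])
      (by simp [hcol]) (by simp) (by simp [hz]) (by simp [ht]) (by simp)).seq <|
    (does_copy_reverse_out (l := encodeNums (List.range' (n + D) D))
      (o := o ++ encodeNum i ++ encodeNums (List.range' n D) ++ encodeNums (topVertices n i a))
      (by simp) (by simp) (by simp [hb']) (by simp) (by simp [ht])).seq <|
    -- On `low` the vertex met last is on top, so the non-neighbours are written in decreasing
    -- order; hence the `reverse` in `voteList`.
    (does_move (lx := encodeNums (bottomVertices n i a).reverse)
      (ly := (o ++ encodeNum i ++ encodeNums (List.range' n D) ++ encodeNums (topVertices n i a) ++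
        encodeNums (List.range' (n + D) D)).reverse) (by simp) (by simp) (by simp)).seq <|
    (does_clear (l := ones n) (by simp)).seq <|
    (does_push (l := ones i) (by simp [hrow]))).mono ?_ ?_
  · simp only [List.length_replicate, rowTime]
    have : n * (5 * n + 7) = 5 * (n * n) + 7 * n := by ring
    omega
  · funext x
    cases x
    case out =>
      simp only [voteList, encodeNums_append, encodeNums_singleton]
      simp [encodeNums]
    case idx => simp [hidx]; omega
    all_goals simp [hcol, hz, hcnt, List.replicate_succ]

/-- Read an adjacency matrix, and write the election of the graph. -/
def graphProg : Prog Γ₂ τ :=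
  copy .num .cnt .tmp ;; forEach .cnt Frag.skip rowProg ;; clear .row

/-- A bound on the running time of `graphProg`. -/
def graphTime (n D : ℕ) : ℕ := n * (rowTime n D + 1) + 7 * n + 4

theorem does_graphProg {s : RegFile} {n D : ℕ} {A : ℕ → ℕ → Bool} {rest o : List Bool}
    (hn : s .num = ones n) (hrow : s .row = [])
    (hb : s .blk = (encodeNums (List.range' n D)).reverse)
    (hb' : s .blk' = (encodeNums (List.range' (n + D) D)).reverse)
    (hi : s .inp = ((List.range n).flatMap fun i => (List.range n).map (A i)) ++ rest)
    (ho : s .out = o.reverse)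
    (hcol : s .col = []) (hz : s .low = []) (hc : s .cnt = []) (hcnt : s .cnt' = [])
    (hidx : s .idx = []) (ht : s .tmp = []) :
    Does (graphProg : Prog Γ₂ τ) s (graphTime n D)
      (Function.update (Function.update s .inp rest) .out
        (o ++ (List.range n).flatMap fun i => encodeNums (voteList n D i (A i))).reverse) := by
  let f : ℕ → RegFile := fun t =>
    (Function.update (Function.update (Function.update (Function.update s .cnt (ones (n - t)))
      .row (ones t)) .inp
      (((List.range' t (n - t)).flatMap fun i => (List.range n).map (A i)) ++ rest)) .out
      (o ++ (List.range t).flatMap fun i => encodeNums (voteList n D i (A i))).reverse)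
  have h := does_forEach_replicate (Γ₂ := Γ₂) (τ := τ) (k := .cnt) (m := n) (PF := Frag.skip)
    (PT := rowProg) (T := rowTime n D) f
    (fun t _ => by simp [f]) (fun t htn => by
      refine (does_rowProg (n := n) (D := D) (i := t) (a := A t)
        (rest := ((List.range' (t + 1) (n - (t + 1))).flatMap fun i =>
          (List.range n).map (A i)) ++ rest)
        (o := o ++ (List.range t).flatMap fun i => encodeNums (voteList n D i (A i)))
        htn ?_ ?_ ?_ ?_ ?_ ?_ ?_ ?_ ?_ ?_ ?_).mono le_rfl ?_
      · simp [f, hn]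
      · simp [f]
      · simp [f, hb]
      · simp [f, hb']
      · have : n - t = (n - (t + 1)) + 1 := by omega
        simp [f, this, List.range'_succ]
      · simp [f]
      · simp [f, hcol]
      · simp [f, hz]
      · simp [f, hcnt]
      · simp [f, hidx]
      · simp [f, ht]
      · funext x
        cases x <;> simp [f, Nat.sub_sub, List.range_succ])
  have h0 : f 0 = Function.update s .cnt (ones n) := by
    funext x
    cases x <;> simp [f, hi, ho, hrow, List.range_eq_range']
  rw [h0] at h
  refine ((does_copy (lx := ones n) (ly := []) (by simp) (by simp) (by simp) hn hc ht).seq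
    ((h.mono (T' := n * (rowTime n D + 1) + 1) (s'' := f n) le_rfl rfl |> fun h => by
      simpa using h : Does _ (Function.update s .cnt (ones n ++ [])) _ _).seq
      (does_clear (l := ones n) (by simp [f])))).mono ?_ ?_
  · simp [graphTime]; omega
  · funext x
    cases x <;> simp [f, hrow, hc]

end Programs

/-! ### Preparation, comparison of vertex numbers, and the final decision. -/

section Programs

variable {K₂ : Type} [DecidableEq K₂] {Γ₂ : K₂ → Type} {τ : Type}

/-- The contents of the stacks while the elections are written. -/
def builtFile (n D : ℕ) (inp out : List Bool) : RegFile
  | .num => ones n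
  | .dum => ones D
  | .blk => (encodeNums (List.range' n D)).reverse
  | .blk' => (encodeNums (List.range' (n + D) D)).reverse
  | .inp => inp
  | .out => out
  | _ => []

/-- Read the number of vertices and prepare everything for writing the elections. -/
def buildProg (q : ℕ) : Prog Γ₂ τ :=
  readNum .num ;; powProg q ;; copy .num .col .tmp ;; blockProg .blk ;; blockProg .blk' ;;
    writeNum .col ;; writeNum .num ;; clear .col

/-- The running time of `buildProg`. -/
def buildTime (q n : ℕ) : ℕ :=
  20 * n + powTime n q + 30 * (n + 2) ^ q + 20 +
    2 * ((n + 2) ^ q * (5 * (n + 2 * (n + 2) ^ q) + 5))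

theorem does_buildProg (q n : ℕ) (l : List Bool) :
    Does (buildProg q : Prog Γ₂ τ) (Function.update (fun _ => []) .inp (encodeNum n ++ l))
      (buildTime q n) (builtFile n ((n + 2) ^ q) l
        (encodeNum (n + 2 * (n + 2) ^ q) ++ encodeNum n).reverse) := by
  have h := (does_readNum (Γ₂ := Γ₂) (τ := τ) (x := .num)
    (s := Function.update (fun _ => []) .inp (encodeNum n ++ l)) (k := n) (l := l) (lx := [])
      (by simp) (by simp) (by simp)).seq <|
    (does_powProg q (n := n) (by simp) (by simp) (by simp) (by simp)).seq <|
    (does_copy (x := .num) (y := .col) (t := .tmp) (lx := ones n) (ly := []) (by simp) (by simp)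
      (by simp) (by simp) (by simp) (by simp)).seq <|
    (does_blockProg (b := .blk) (D := (n + 2) ^ q) (x := n) (by simp) (by simp) (by simp)
      (by simp) (by simp) (by simp)).seq <|
    (does_blockProg (b := .blk') (D := (n + 2) ^ q) (x := n + (n + 2) ^ q) (by simp) (by simp)
      (by simp) (by simp) (by simp) (by simp)).seq <|
    (does_writeNum (x := .col) (k := n + (n + 2) ^ q + (n + 2) ^ q) (o := []) (by simp) (by simp)
      (by simp) (by simp) (by simp)).seq <|
    (does_writeNum (x := .num) (k := n) (o := encodeNum (n + (n + 2) ^ q + (n + 2) ^ q)) (by simp)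
      (by simp) (by simp) (by simp) (by simp)).seq <|
    (does_clear (x := .col) (l := ones (n + (n + 2) ^ q + (n + 2) ^ q)) (by simp))
  refine h.mono ?_ ?_
  · simp only [List.length_replicate, buildTime]
    generalize (n + 2) ^ q = D
    have h1 : D * (5 * (n + D) + 5) ≤ D * (5 * (n + 2 * D) + 5) :=
      Nat.mul_le_mul_left _ (by omega)
    have h2 : D * (5 * (n + D + D) + 5) = D * (5 * (n + 2 * D) + 5) := by ring
    omega
  · funext x
    cases x <;> simp [builtFile, two_mul, add_assoc]

theorem does_graphProg_builtFile {n D : ℕ} {A : ℕ → ℕ → Bool} {rest o : List Bool} :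
    Does (graphProg : Prog Γ₂ τ)
      (builtFile n D (((List.range n).flatMap fun i => (List.range n).map (A i)) ++ rest) o.reverse)
      (graphTime n D) (builtFile n D rest
        (o ++ (List.range n).flatMap fun i => encodeNums (voteList n D i (A i))).reverse) := by
  refine (does_graphProg (n := n) (D := D) (A := A) (rest := rest) (o := o) rfl rfl rfl rfl rfl rfl
    rfl rfl rfl rfl rfl rfl).mono le_rfl ?_
  funext x
  cases x <;> simp [builtFile]

/-- Compare the numbers of vertices: `flag` remains empty if they are equal. -/
def compareProg : Prog Γ₂ τ :=
  readNum .num' ;; copy .num .cnt .tmp ;;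
    forEach .num' Frag.skip (popCase .cnt (push .flag true) Frag.skip Frag.skip) ;;
    popCase .cnt Frag.skip (push .flag true) (push .flag true)

/-- The unary numbers are cancelled against each other. Each unit of `n'` in excess of `n` sets a
flag bit, and a remainder of `n` sets one, so `flag` is empty exactly when the numbers agree. -/
theorem does_compareProg (n n' D : ℕ) (l o : List Bool) :
    Does (compareProg : Prog Γ₂ τ) (builtFile n D (encodeNum n' ++ l) o) (5 * n + 5 * n' + 6)
      (Function.update (Function.update (builtFile n D l o) .cnt (ones (n - n' - 1))) .flag
        (ones (if n' < n then 1 else n' - n))) := by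
  let f : ℕ → RegFile := fun t =>
    (Function.update (Function.update (Function.update (builtFile n D l o) .num' (ones (n' - t)))
      .cnt (ones (n - t))) .flag (ones (t - n)))
  have h := does_forEach_replicate (Γ₂ := Γ₂) (τ := τ) (k := .num') (m := n') (PF := Frag.skip)
    (PT := popCase .cnt (push .flag true) Frag.skip Frag.skip) (T := 2) f
    (fun t _ => by simp [f]) (fun t ht => by
      by_cases htn : n ≤ t
      · refine (does_popCase_nil (by simp [f]; omega) (does_push (l := ones (t - n))
          (by simp [f]))).mono le_rfl ?_
        have h1 : t + 1 - n = (t - n) + 1 := by omega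
        have h2 : n - t = 0 := by omega
        have h3 : n - (t + 1) = 0 := by omega
        funext x
        cases x <;> simp [f, Nat.sub_sub, h1, h2, h3, List.replicate_succ]
      · have h1 : n - t = (n - (t + 1)) + 1 := by omega
        refine (does_popCase_true (l := ones (n - (t + 1))) (by simp [f, h1, List.replicate_succ])
          (does_skip _)).mono le_rfl ?_
        have h2 : t - n = 0 := by omega
        have h3 : t + 1 - n = 0 := by omega
        funext x
        cases x <;> simp [f, Nat.sub_sub, h2, h3])
  have h2 : Does (popCase .cnt Frag.skip (push .flag true) (push .flag true) : Prog Γ₂ τ) (f n') 2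
      (Function.update (Function.update (builtFile n D l o) .cnt (ones (n - n' - 1))) .flag
        (ones (if n' < n then 1 else n' - n))) := by
    by_cases hlt : n' < n
    · have h1 : n - n' = (n - n' - 1) + 1 := by omega
      refine (does_popCase_true (l := ones (n - n' - 1))
        (by simp only [f]; rw [h1]; simp [List.replicate_succ])
        (does_push (l := []) (by simp [f]; omega))).mono le_rfl ?_
      funext x
      cases x <;> simp [f, builtFile, hlt]
    · have h1 : n - n' = 0 := by omega
      refine (does_popCase_nil (by simp [f, h1]) (does_skip _)).mono le_rfl ?_
      funext x
      cases x <;> simp [f, builtFile, hlt, h1]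
  have h0 : f 0 = Function.update (Function.update (Function.update
      (builtFile n D (encodeNum n' ++ l) o) .inp l) .num' (ones n' ++ [])) .cnt (ones n ++ []) := by
    funext x
    cases x <;> simp [f, builtFile]
  rw [h0] at h
  refine ((does_readNum (k := n') (l := l) (lx := []) (by simp) (by simp [builtFile])
      (by simp [builtFile])).seq <|
    (does_copy (s := Function.update (Function.update (builtFile n D (encodeNum n' ++ l) o)
        .inp l) .num' (ones n' ++ [])) (lx := ones n) (ly := []) (by simp) (by simp) (by simp)
      (by simp [builtFile]) (by simp [builtFile]) (by simp [builtFile])).seq <|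
    h.seq h2).mono ?_ rfl
  simp; omega

/-- Halve the contents of `dum`. -/
def halveProg : Prog Γ₂ τ :=
  forEach .dum Frag.skip (popCase .dum Frag.skip Frag.skip (push .low true)) ;; move .low .dum

/-- Each round removes two units from `dum` and adds one to `low`; a single last unit is lost, which
is rounding down. -/
theorem does_halve_loop (d : ℕ) : ∀ {s : RegFile} {c : ℕ}, s .dum = ones d → s .low = ones c →
    Does (forEach .dum Frag.skip (popCase .dum Frag.skip Frag.skip (push .low true)) : Prog Γ₂ τ)
      s (2 * d + 2) (Function.update (Function.update s .dum []) .low (ones (d / 2 + c))) := by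
  induction d using Nat.twoStepInduction with
  | zero =>
    intro s c hd hl
    refine (does_forEach_nil hd).mono (by omega) ?_
    funext x; cases x <;> simp [hd, hl]
  | one =>
    intro s c hd hl
    refine (does_forEach_cons (b := true) (l := []) hd
      (does_popCase_nil (by simp) (does_skip _)) (does_forEach_nil (by simp))).mono (by omega) ?_
    funext x; cases x <;> simp [hl]
  | more d ih _ =>
    intro s c hd hl
    refine (does_forEach_cons (b := true) (l := ones (d + 1)) hd
      (does_popCase_true (l := ones d) (by simp [List.replicate_succ])
        (does_push (l := ones c) (by simp [hl]))) (ih (c := c + 1) ?_ ?_)).mono (by omega) ?_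
    · simp
    · simp [List.replicate_succ]
    · have : d / 2 + (c + 1) = d / 2 + 1 + c := by omega
      funext x; cases x <;> simp [this]

theorem does_halveProg {s : RegFile} {d : ℕ} (hd : s .dum = ones d) (hl : s .low = []) :
    Does (halveProg : Prog Γ₂ τ) s (3 * d + 3) (Function.update s .dum (ones (d / 2))) := by
  refine ((does_halve_loop d (c := 0) hd hl).seq (does_move (lx := ones (d / 2)) (ly := [])
    (by simp) (by simp) (by simp))).mono (by simp; omega) ?_
  funext x; cases x <;> simp [hl]

/-- The digits themselves are ignored: only their number counts, so the approximate value never has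
to be expanded into unary. -/
theorem does_forEach_halve (l : List Bool) : ∀ {s : RegFile} {d : ℕ}, s .cnt' = l →
    s .dum = ones d → s .low = [] →
    Does (forEach .cnt' halveProg halveProg : Prog Γ₂ τ) s (l.length * (3 * d + 4) + 1)
      (Function.update (Function.update s .dum (ones (d / 2 ^ l.length))) .cnt' []) := by
  induction l with
  | nil =>
    intro s d hc hd hl
    refine (does_forEach_nil hc).mono (by simp) ?_
    funext x; cases x <;> simp [hc, hd]
  | cons b l ih =>
    intro s d hc hd hl
    have h1 : Does (if b then halveProg else halveProg : Prog Γ₂ τ) (Function.update s .cnt' l)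
        (3 * d + 3) (Function.update (Function.update s .cnt' l) .dum (ones (d / 2))) := by
      have := does_halveProg (Γ₂ := Γ₂) (τ := τ) (s := Function.update s .cnt' l) (d := d)
        (by simp [hd]) (by simp [hl])
      cases b <;> exact this
    refine (does_forEach_cons hc h1 (ih (d := d / 2) ?_ ?_ ?_)).mono ?_ ?_
    · simp
    · simp
    · simp [hl]
    · have : l.length * (3 * (d / 2) + 4) ≤ l.length * (3 * d + 4) :=
        Nat.mul_le_mul_left _ (by omega)
      simp only [List.length_cons, Nat.add_mul]
      omega
    · have : d / 2 / 2 ^ l.length = d / 2 ^ (l.length + 1) := by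
        rw [Nat.div_div_eq_div_mul, pow_succ']
      funext x; cases x <;> simp [this]

/-- Decide whether the number with the binary digits in `cnt'` is small compared to `dum`. -/
def decideProg : Prog Γ₂ τ :=
  forEach .cnt' halveProg halveProg ;; halveProg ;; halveProg ;; halveProg ;;
    popCase .dum (push .res false) (push .res true) (push .res true) ;;
    clearList (Reg.list.filter (· ≠ .res))

/-- The contents of the stacks at the end. -/
def finalFile (b : Bool) : RegFile
  | .res => [b]
  | _ => []

/-- The three additional halvings supply a safety factor 8. All stacks but `res` are emptied, as the
final configuration of a machine demands. -/
theorem does_decideProg {s : RegFile} {d L : ℕ} {l : List Bool} (hc : s .cnt' = l)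
    (hd : s .dum = ones d) (hl : s .low = []) (hr : s .res = []) (hs : ∀ x, (s x).length ≤ L) :
    Does (decideProg : Prog Γ₂ τ) s (l.length * (3 * d + 4) + 9 * d + 32 * L + 62)
      (finalFile (decide (1 ≤ d / 2 ^ (l.length + 3)))) := by
  have hdL : d ≤ L := by simpa [hd] using hs .dum
  have he : d / 2 ^ l.length / 2 / 2 / 2 = d / 2 ^ (l.length + 3) := by
    simp only [Nat.div_div_eq_div_mul, pow_succ]
  have hed : d / 2 ^ (l.length + 3) ≤ d := Nat.div_le_self _ _
  have h1 : d / 2 ^ l.length ≤ d := Nat.div_le_self _ _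
  have h := (does_forEach_halve (Γ₂ := Γ₂) (τ := τ) l hc hd hl).seq <|
    (does_halveProg (d := d / 2 ^ l.length) (by simp) (by simp [hl])).seq <|
    (does_halveProg (d := d / 2 ^ l.length / 2) (by simp) (by simp [hl])).seq <|
    (does_halveProg (d := d / 2 ^ l.length / 2 / 2) (by simp) (by simp [hl])).seq <|
    (?_ : Does (popCase .dum (push .res false) (push .res true) (push .res true)) _ 2
      (Function.update (Function.update (Function.update s .cnt' []) .dum
        (ones (d / 2 ^ (l.length + 3) - 1))) .res [decide (1 ≤ d / 2 ^ (l.length + 3))])).seq <|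
    (does_clearList (L := L + 1) (Reg.list.filter (· ≠ .res)) ?_)
  · refine h.mono ?_ ?_
    · have : (Reg.list.filter (· ≠ .res)).length = 15 := rfl
      rw [this]
      omega
    · funext x
      cases x <;> simp [finalFile, Reg.mem_list]
  · rw [he]
    generalize d / 2 ^ (l.length + 3) = e
    cases e with
    | zero =>
      refine (does_popCase_nil (by simp) (does_push (l := []) (by simp [hr]))).mono le_rfl ?_
      funext x; cases x <;> simp
    | succ e =>
      refine (does_popCase_true (l := ones e) (by simp [List.replicate_succ])
        (does_push (l := []) (by simp [hr]))).mono le_rfl ?_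
      funext x; cases x <;> simp
  · intro x
    have hx := hs x
    cases x <;> simp <;> omega

/-- Answer `false`. -/
def rejectProg : Prog Γ₂ τ := clearList Reg.list ;; push .res false

theorem does_rejectProg {s : RegFile} {L : ℕ} (hs : ∀ x, (s x).length ≤ L) :
    Does (rejectProg : Prog Γ₂ τ) s (32 * L + 18) (finalFile false) := by
  refine ((does_clearList Reg.list hs).seq (does_push (l := []) (by simp [Reg.mem_list]))).mono
    ?_ ?_
  · have : Reg.list.length = 16 := rfl
    rw [this]
    omega
  · funext x
    cases x <;> simp [finalFile, Reg.mem_list]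

end Programs

/-! ### Calling the approximation machine as a subroutine. -/

section Call

variable (tm : FinTM2) (x : Bool → tm.Γ tm.k₀) (y : tm.Γ tm.k₁ → Bool)

/-- Move `out` to the input stack of `tm`. -/
def sendProg : Prog tm.Γ tm.σ :=
  Frag.loop (Γ := Sum.elim _ tm.Γ) (.inl .out) id false
    (Frag.push (Γ := Sum.elim _ tm.Γ) (.inr tm.k₀) (x false))
    (Frag.push (Γ := Sum.elim _ tm.Γ) (.inr tm.k₀) (x true))

/-- Move the output of `tm` to `cnt'`. -/
def receiveProg : Prog tm.Γ tm.σ :=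
  Frag.loop (Γ := Sum.elim _ tm.Γ) (.inr tm.k₁) y false (push .cnt' false) (push .cnt' true)

/-- Run `tm`. -/
def liftProg : Prog tm.Γ tm.σ where
  Λ := tm.Λ
  fin := tm.ΛFin
  entry := tm.main
  code l := liftStmt _ _ (tm.m l)

theorem runs_sendProg (w : tm.σ) (l : List Bool) : ∀ {s : RegFile} {r : ∀ k, List (tm.Γ k)},
    s .out = l → Frag.Runs (sendProg tm x) (none, w) (joinStacks s r) (2 * l.length + 1)
      (joinStacks (Function.update s .out [])
        (Function.update r tm.k₀ (l.reverse.map x ++ r tm.k₀))) := by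
  induction l with
  | nil =>
    intro s r hs
    refine (Frag.runs_loop_nil (Γ := Sum.elim _ tm.Γ) (k := .inl Reg.out)
      (S := joinStacks s r) hs).mono (by simp) ?_
    rw [← hs, Function.update_eq_self, hs]
    simp
  | cons b l ih =>
    intro s r hs
    have h1 : Frag.Runs (Γ := Sum.elim (fun _ : Reg => Bool) tm.Γ) (σ := Option Bool × tm.σ)
        (Frag.push (.inr tm.k₀) (x b)) (none, w) (joinStacks (Function.update s .out l) r) 1
        (joinStacks (Function.update s .out l) (Function.update r tm.k₀ (x b :: r tm.k₀))) := by
      rw [← update_joinStacks_inr]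
      exact Frag.runs_push (Γ := Sum.elim (fun _ : Reg => Bool) tm.Γ) (.inr tm.k₀) (x b) _
        (joinStacks (Function.update s .out l) r)
    have h2 := ih (s := Function.update s .out l) (r := Function.update r tm.k₀ (x b :: r tm.k₀))
      (by simp)
    have h3 : joinStacks (Function.update (Function.update s .out l) .out [])
        (Function.update (Function.update r tm.k₀ (x b :: r tm.k₀)) tm.k₀
          (l.reverse.map x ++ Function.update r tm.k₀ (x b :: r tm.k₀) tm.k₀)) =
        joinStacks (Function.update s .out [])
          (Function.update r tm.k₀ ((b :: l).reverse.map x ++ r tm.k₀)) := by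
      simp
    rw [h3] at h2
    cases b with
    | false =>
      exact (Frag.runs_loop_false (Γ := Sum.elim _ tm.Γ) (k := .inl Reg.out)
        (S := joinStacks s r) (x := false) (l := l) hs rfl
        (by rw [update_joinStacks_inl]; exact h1) h2).mono (by simp; omega) rfl
    | true =>
      exact (Frag.runs_loop_true (Γ := Sum.elim _ tm.Γ) (k := .inl Reg.out)
        (S := joinStacks s r) (x := true) (l := l) hs rfl
        (by rw [update_joinStacks_inl]; exact h1) h2).mono (by simp; omega) rfl

theorem runs_receiveProg (w : tm.σ) (l : List (tm.Γ tm.k₁)) :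
    ∀ {s : RegFile} {r : ∀ k, List (tm.Γ k)}, r tm.k₁ = l →
      Frag.Runs (receiveProg tm y) (none, w) (joinStacks s r) (2 * l.length + 1)
        (joinStacks (Function.update s .cnt' (l.reverse.map y ++ s .cnt'))
          (Function.update r tm.k₁ [])) := by
  induction l with
  | nil =>
    intro s r hr
    refine (Frag.runs_loop_nil (Γ := Sum.elim _ tm.Γ) (k := .inr tm.k₁)
      (S := joinStacks s r) hr).mono (by simp) ?_
    rw [← hr, Function.update_eq_self, hr]
    simp
  | cons b l ih =>
    intro s r hr
    have h1 : ∀ c, Frag.Runs (push .cnt' c : Prog tm.Γ tm.σ) (none, w)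
        (joinStacks s (Function.update r tm.k₁ l)) 1
        (joinStacks (Function.update s .cnt' (c :: s .cnt')) (Function.update r tm.k₁ l)) :=
      fun c => does_push rfl w _
    have h2 := ih (s := Function.update s .cnt' (y b :: s .cnt')) (r := Function.update r tm.k₁ l)
      (by simp)
    have h3 : joinStacks (Function.update (Function.update s .cnt' (y b :: s .cnt')) .cnt'
          (l.reverse.map y ++ Function.update s .cnt' (y b :: s .cnt') .cnt'))
          (Function.update (Function.update r tm.k₁ l) tm.k₁ []) =
        joinStacks (Function.update s .cnt' ((b :: l).reverse.map y ++ s .cnt'))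
          (Function.update r tm.k₁ []) := by
      simp
    rw [h3] at h2
    cases hb : y b with
    | false =>
      rw [hb] at h2
      exact (Frag.runs_loop_false (Γ := Sum.elim _ tm.Γ) (k := .inr tm.k₁)
        (S := joinStacks s r) (x := b) (l := l) hr hb
        (by rw [update_joinStacks_inr]; exact h1 false) h2).mono (by simp; omega) rfl
    | true =>
      rw [hb] at h2
      exact (Frag.runs_loop_true (Γ := Sum.elim _ tm.Γ) (k := .inr tm.k₁)
        (S := joinStacks s r) (x := b) (l := l) hr hb
        (by rw [update_joinStacks_inr]; exact h1 true) h2).mono (by simp; omega) rfl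

theorem initList_stk (l : List (tm.Γ tm.k₀)) :
    (initList tm l).stk = Function.update (fun _ => []) tm.k₀ l := by
  funext k
  by_cases h : k = tm.k₀
  · subst h; simp [initList]
  · simp [initList, h]

theorem haltList_stk (l : List (tm.Γ tm.k₁)) :
    (haltList tm l).stk = Function.update (fun _ => []) tm.k₁ l := by
  funext k
  by_cases h : k = tm.k₁
  · subst h; simp [haltList]
  · simp [haltList, h]

/-- Run `tm` on the contents of `out`, and write the output to `cnt'`. -/
def callProg : Prog tm.Γ tm.σ := sendProg tm x ;; liftProg tm ;; receiveProg tm y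

/-- A halting configuration has the initial memory and only the output stack filled, so after the
output is fetched all stacks of `tm` are empty. Sending and receiving reverse their lists: `out` was
reversed already, and `cnt'` receives the digits reversed, which is harmless. -/
theorem runs_callProg {l l' : List Bool} {lm : List (tm.Γ tm.k₁)} {T : ℕ} {s : RegFile}
    (hout : s .out = l.reverse) (hcnt : s .cnt' = []) (hlm : lm.map y = l')
    (h : TM2OutputsInTime tm (l.map x) (some lm) T) :
    Frag.Runs (callProg tm x y) (none, tm.initialState) (joinStacks s fun _ => [])
      (2 * l.length + T + 2 * l'.length + 2)
      (joinStacks (Function.update (Function.update s .out []) .cnt' l'.reverse) fun _ => []) := by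
  have h1 := runs_sendProg tm x tm.initialState l.reverse (r := fun _ => []) hout
  have h2 : Steps tm.m h.steps (initList tm (l.map x)) (haltList tm lm) :=
    Steps.of_iterate h.evals_in_steps
  have h3 := Steps.lift h2 (none : Option Bool) (Function.update s .out [])
  have h4 : Frag.Runs (liftProg tm) (none, tm.initialState)
      (joinStacks (Function.update s .out []) (Function.update (fun _ => []) tm.k₀ (l.map x))) T
      (joinStacks (Function.update s .out []) (Function.update (fun _ => []) tm.k₁ lm)) := by
    refine ⟨h.steps, h.steps_le_m, ?_⟩
    rw [← initList_stk, ← haltList_stk]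
    exact h3
  have h5 := runs_receiveProg tm y tm.initialState lm (s := Function.update s .out [])
    (r := Function.update (fun _ => []) tm.k₁ lm) (by simp)
  subst hlm
  refine (h1.seq (Frag.Runs.seq (by simpa using h4) h5)).mono (by simp; omega) ?_
  simp [hcnt]

end Call

/-! ### The complete algorithm for Graph Isomorphism. -/

section Reduction

variable (tm : FinTM2) (x : Bool → tm.Γ tm.k₀) (y : tm.Γ tm.k₁ → Bool) (q : ℕ)

/-- The whole algorithm for Graph Isomorphism. -/
def mainProg : Prog tm.Γ tm.σ :=
  buildProg q ;; graphProg ;; compareProg ;;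
    popCase .flag (graphProg ;; callProg tm x y ;; decideProg) rejectProg rejectProg

theorem length_voteList_code_le {n D i : ℕ} {a : ℕ → Bool} (hi : i < n) :
    (encodeNums (voteList n D i a)).length ≤ (n + 2 * D) * (n + 2 * D) := by
  have hp := voteList_perm (D := D) a hi
  have h := length_encodeNums_le (L := voteList n D i a) (m := n + 2 * D)
    fun c hc => List.mem_range.1 (hp.mem_iff.1 hc)
  rwa [hp.length_eq, List.length_range] at h

theorem length_election_code_le {n D : ℕ} (A : ℕ → ℕ → Bool) :
    ((List.range n).flatMap fun i => encodeNums (voteList n D i (A i))).length ≤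
      n * ((n + 2 * D) * (n + 2 * D)) := by
  rw [List.length_flatMap]
  have := List.sum_le_card_nsmul
    ((List.range n).map fun i => (encodeNums (voteList n D i (A i))).length)
    ((n + 2 * D) * (n + 2 * D)) (by
      simp only [List.mem_map, List.mem_range]
      rintro _ ⟨i, hi, rfl⟩
      exact length_voteList_code_le hi)
  simpa using this

/-- A bound on the length of the instance written. -/
def codeLength (n D : ℕ) : ℕ := 2 * n + 2 * D + 2 + 2 * (n * ((n + 2 * D) * (n + 2 * D)))

/-- A bound on the contents of the stacks. -/
def fileBound (n D : ℕ) : ℕ := n + D + 2 + D * (n + 2 * D) + codeLength n D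

theorem length_builtFile_le {n D : ℕ} {l o : List Bool} (ho : o.length ≤ codeLength n D) (z : Reg) :
    (builtFile n D l o z).length ≤ fileBound n D + l.length := by
  have hl1 : (encodeNums (List.range' n D)).length ≤ D * (n + 2 * D) := by
    simpa using length_encodeNums_le (L := List.range' n D) (m := n + 2 * D) (by simp; omega)
  have hl2 : (encodeNums (List.range' (n + D) D)).length ≤ D * (n + 2 * D) := by
    simpa using length_encodeNums_le (L := List.range' (n + D) D) (m := n + 2 * D) (by simp; omega)
  cases z <;> simp [builtFile, fileBound] <;> omega

/-- The adjacency matrix. -/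
def matrixCode (n : ℕ) (A : ℕ → ℕ → Bool) : List Bool :=
  (List.range n).flatMap fun i => (List.range n).map (A i)

/-- The code of the instance written. -/
def instanceCode (n D : ℕ) (A B : ℕ → ℕ → Bool) : List Bool :=
  encodeNum (n + 2 * D) ++ encodeNum n ++
    ((List.range n).flatMap fun i => encodeNums (voteList n D i (A i))) ++
    ((List.range n).flatMap fun i => encodeNums (voteList n D i (B i)))

theorem length_instanceCode_le (n D : ℕ) (A B : ℕ → ℕ → Bool) :
    (instanceCode n D A B).length ≤ codeLength n D := by
  have h1 := length_election_code_le (n := n) (D := D) A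
  have h2 := length_election_code_le (n := n) (D := D) B
  simp only [instanceCode, List.length_append, length_encodeNum, codeLength]
  omega

/-- The running time of the first part of `mainProg`. -/
def prepareTime (n n' : ℕ) : ℕ := buildTime q n + (graphTime n ((n + 2) ^ q) + (5 * n + 5 * n' + 6))

/-- The mismatch is noticed only after the first election has been written; everything is then
erased and the machine is never called. -/
theorem runs_mainProg_of_ne {n n' : ℕ} (hne : n ≠ n') (A B : ℕ → ℕ → Bool) :
    Frag.Runs (mainProg tm x y q) (none, tm.initialState)
      (joinStacks (Function.update (fun _ => []) .inp
        (encodeNum n ++ matrixCode n A ++ (encodeNum n' ++ matrixCode n' B))) fun _ => [])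
      (prepareTime q n n' + 32 * (fileBound n ((n + 2) ^ q) + n' * n' + n') + 19)
      (joinStacks (finalFile false) fun _ => []) := by
  set D := (n + 2) ^ q with hD
  set o := (encodeNum (n + 2 * D) ++ encodeNum n) ++
    (List.range n).flatMap fun i => encodeNums (voteList n D i (A i)) with ho
  have hol : o.reverse.length ≤ codeLength n D := by
    have h1 := length_election_code_le (n := n) (D := D) A
    simp only [ho, List.length_append, length_encodeNum, codeLength, List.length_reverse]
    omega
  have hml : (matrixCode n' B).length = n' * n' := by simp [matrixCode]
  set s : RegFile := Function.update (Function.update (builtFile n D (matrixCode n' B) o.reverse)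
    .cnt (ones (n - n' - 1))) .flag (ones (if n' < n then 1 else n' - n)) with hs
  have hsl : ∀ z, (s z).length ≤ fileBound n D + n' * n' + n' := by
    intro z
    have h := length_builtFile_le (l := matrixCode n' B) hol z
    have h' : n + 2 ≤ fileBound n D := by rw [fileBound]; omega
    rw [hml] at h
    by_cases h1 : z = .flag
    · subst h1
      simp only [hs, Function.update_self, List.length_replicate]
      split_ifs <;> omega
    · by_cases h2 : z = .cnt
      · subst h2
        simp [hs]
        omega
      · simp only [hs, Function.update_of_ne h1, Function.update_of_ne h2]
        omega
  have h2 : Does (popCase .flag (graphProg ;; callProg tm x y ;; decideProg) rejectProg rejectProg :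
      Prog tm.Γ tm.σ) s (32 * (fileBound n D + n' * n' + n') + 18 + 1) (finalFile false) := by
    obtain ⟨m, hm⟩ : ∃ m, (if n' < n then 1 else n' - n) = m + 1 :=
      Nat.exists_eq_succ_of_ne_zero (by split_ifs <;> omega)
    refine does_popCase_true (l := ones m) ?_ (does_rejectProg fun z => ?_)
    · simp [hs, hm, List.replicate_succ]
    · by_cases h1 : z = .flag
      · subst h1
        have := hsl .flag
        simp only [hs, Function.update_self, hm, List.length_replicate] at this ⊢
        omega
      · rw [Function.update_of_ne h1]
        exact hsl z
  rw [List.append_assoc]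
  exact (((does_buildProg q n _).seq (does_graphProg_builtFile.seq
    ((does_compareProg n n' D (matrixCode n' B) _).seq h2))) _ _).mono
      (by simp only [prepareTime, ← hD]; omega) rfl

theorem runs_mainProg_of_eq {n : ℕ} (A B : ℕ → ℕ → Bool) {l : List Bool} {lm : List (tm.Γ tm.k₁)}
    {T : ℕ} (hlm : lm.map y = l)
    (h : TM2OutputsInTime tm ((instanceCode n ((n + 2) ^ q) A B).map x) (some lm) T) :
    Frag.Runs (mainProg tm x y q) (none, tm.initialState)
      (joinStacks (Function.update (fun _ => []) .inp
        (encodeNum n ++ matrixCode n A ++ (encodeNum n ++ matrixCode n B))) fun _ => [])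
      (prepareTime q n n + (graphTime n ((n + 2) ^ q) + (2 * codeLength n ((n + 2) ^ q) + T +
        2 * l.length + 2) + (l.length * (3 * (n + 2) ^ q + 4) + 9 * (n + 2) ^ q +
          32 * (fileBound n ((n + 2) ^ q) + l.length) + 62) + 1))
      (joinStacks (finalFile (decide (1 ≤ (n + 2) ^ q / 2 ^ (l.length + 3)))) fun _ => []) := by
  generalize hD' : (n + 2) ^ q = D at h ⊢
  set o := (encodeNum (n + 2 * D) ++ encodeNum n) ++
    (List.range n).flatMap fun i => encodeNums (voteList n D i (A i)) with ho
  have hflag : Function.update (Function.update (builtFile n D (matrixCode n B) o.reverse)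
      .cnt (ones (n - n - 1))) .flag (ones (if n < n then 1 else n - n)) =
      builtFile n D (matrixCode n B ++ []) o.reverse := by
    funext z
    cases z <;> simp [builtFile]
  have hcl := length_instanceCode_le n D A B
  have hw := runs_callProg tm x y (s := builtFile n D [] (instanceCode n D A B).reverse) rfl rfl
    hlm h
  have hdec := does_decideProg (Γ₂ := tm.Γ) (τ := tm.σ)
    (s := Function.update (Function.update (builtFile n D [] (instanceCode n D A B).reverse)
      .out []) .cnt' l.reverse) (d := D) (L := fileBound n D + l.length) (l := l.reverse)
    (by simp) (by simp [builtFile]) (by simp [builtFile]) (by simp [builtFile]) (by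
      intro z
      have hz := length_builtFile_le (n := n) (D := D) (l := [])
        (o := (instanceCode n D A B).reverse) (by simpa using hcl) z
      by_cases h1 : z = .cnt'
      · subst h1
        simp
      · by_cases h2 : z = .out
        · subst h2
          simp
        · simp only [Function.update_of_ne h1, Function.update_of_ne h2]
          simp only [List.length_nil] at hz
          omega)
  have hcase : Frag.Runs (popCase .flag (graphProg ;; callProg tm x y ;; decideProg) rejectProg
      rejectProg : Prog tm.Γ tm.σ) (none, tm.initialState)
      (joinStacks (builtFile n D (matrixCode n B ++ []) o.reverse) fun _ => []) _ _ :=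
    Frag.runs_popCase_nil (Γ := Sum.elim _ tm.Γ) (k := .inl Reg.flag)
      (S := joinStacks (builtFile n D (matrixCode n B ++ []) o.reverse) fun _ => []) rfl
      (Frag.Runs.seq (does_graphProg_builtFile _ _) (Frag.Runs.seq hw (hdec _ _)))
  have hcmp := does_compareProg (Γ₂ := tm.Γ) (τ := tm.σ) n n D (matrixCode n B) o.reverse
  rw [hflag] at hcmp
  have hbuild := does_buildProg (Γ₂ := tm.Γ) (τ := tm.σ) q n
    (matrixCode n A ++ (encodeNum n ++ matrixCode n B))
  rw [hD'] at hbuild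
  rw [List.append_assoc]
  refine (Frag.Runs.seq (hbuild _ _) (Frag.Runs.seq (does_graphProg_builtFile _ _)
    (Frag.Runs.seq (hcmp _ _) hcase))).mono ?_ ?_
  · simp only [prepareTime, hD', List.length_reverse]
    omega
  · rw [List.length_reverse]

end Reduction

/-! ### Polynomial bounds for the running times. -/

section PolynomialBounds

/-- The function `f` is bounded by a polynomial. -/
def PolyBdd (f : ℕ → ℕ) : Prop := ∃ p : Polynomial ℕ, ∀ n, f n ≤ p.eval n

theorem eval_mono (p : Polynomial ℕ) {a b : ℕ} (h : a ≤ b) : p.eval a ≤ p.eval b := by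
  rw [Polynomial.eval_eq_sum, Polynomial.eval_eq_sum]
  exact Finset.sum_le_sum fun i _ => Nat.mul_le_mul_left _ (Nat.pow_le_pow_left h i)

theorem PolyBdd.const (c : ℕ) : PolyBdd fun _ => c := ⟨Polynomial.C c, by simp⟩

theorem PolyBdd.id : PolyBdd fun n => n := ⟨Polynomial.X, by simp⟩

theorem PolyBdd.add {f g : ℕ → ℕ} (hf : PolyBdd f) (hg : PolyBdd g) : PolyBdd fun n => f n + g n := by
  obtain ⟨p, hp⟩ := hf
  obtain ⟨r, hr⟩ := hg
  exact ⟨p + r, fun n => by rw [Polynomial.eval_add]; exact Nat.add_le_add (hp n) (hr n)⟩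

theorem PolyBdd.mul {f g : ℕ → ℕ} (hf : PolyBdd f) (hg : PolyBdd g) : PolyBdd fun n => f n * g n := by
  obtain ⟨p, hp⟩ := hf
  obtain ⟨r, hr⟩ := hg
  exact ⟨p * r, fun n => by rw [Polynomial.eval_mul]; exact Nat.mul_le_mul (hp n) (hr n)⟩

theorem PolyBdd.pow {f : ℕ → ℕ} (hf : PolyBdd f) (k : ℕ) : PolyBdd fun n => f n ^ k := by
  obtain ⟨p, hp⟩ := hf
  exact ⟨p ^ k, fun n => by rw [Polynomial.eval_pow]; exact Nat.pow_le_pow_left (hp n) k⟩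

theorem PolyBdd.eval {f : ℕ → ℕ} (hf : PolyBdd f) (r : Polynomial ℕ) :
    PolyBdd fun n => r.eval (f n) := by
  obtain ⟨p, hp⟩ := hf
  exact ⟨r.comp p, fun n => by rw [Polynomial.eval_comp]; exact eval_mono r (hp n)⟩

theorem polyBdd_powTime (q : ℕ) : PolyBdd fun n => powTime n q := by
  induction q with
  | zero => exact PolyBdd.const 1
  | succ q ih =>
    exact ih.add ((((PolyBdd.id.add (.const 2)).pow q).mul
      (((PolyBdd.const 7).mul .id).add (.const 9))).add (.const 2))

theorem polyBdd_dummies (q : ℕ) : PolyBdd fun n => (n + 2) ^ q :=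
  (PolyBdd.id.add (.const 2)).pow q

theorem polyBdd_numCand (q : ℕ) : PolyBdd fun n => n + 2 * (n + 2) ^ q :=
  PolyBdd.id.add ((PolyBdd.const 2).mul (polyBdd_dummies q))

theorem polyBdd_buildTime (q : ℕ) : PolyBdd fun n => buildTime q n :=
  ((((((PolyBdd.const 20).mul .id).add (polyBdd_powTime q)).add
    ((PolyBdd.const 30).mul (polyBdd_dummies q))).add (.const 20)).add
    ((PolyBdd.const 2).mul ((polyBdd_dummies q).mul
      (((PolyBdd.const 5).mul (polyBdd_numCand q)).add (.const 5)))))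

theorem polyBdd_graphTime (q : ℕ) : PolyBdd fun n => graphTime n ((n + 2) ^ q) :=
  ((PolyBdd.id.mul ((((((PolyBdd.const 10).mul ((polyBdd_dummies q).mul (polyBdd_numCand q))).add
    ((PolyBdd.const 7).mul (PolyBdd.id.mul .id))).add ((PolyBdd.const 24).mul .id)).add
    (.const 20)).add (.const 1))).add ((PolyBdd.const 7).mul .id)).add (.const 4)

theorem polyBdd_codeLength (q : ℕ) : PolyBdd fun n => codeLength n ((n + 2) ^ q) :=
  ((((PolyBdd.const 2).mul .id).add ((PolyBdd.const 2).mul (polyBdd_dummies q))).add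
    (.const 2)).add ((PolyBdd.const 2).mul
      (PolyBdd.id.mul ((polyBdd_numCand q).mul (polyBdd_numCand q))))

theorem polyBdd_fileBound (q : ℕ) : PolyBdd fun n => fileBound n ((n + 2) ^ q) :=
  (((PolyBdd.id.add (polyBdd_dummies q)).add (.const 2)).add
    ((polyBdd_dummies q).mul (polyBdd_numCand q))).add (polyBdd_codeLength q)

end PolynomialBounds

/-! ### Lengths and shapes of the encodings. -/

section Encodings

theorem length_encodePosNum (p : PosNum) :
    (p : ℕ) < 2 ^ (Computability.encodePosNum p).length ∧
      2 ^ (Computability.encodePosNum p).length ≤ 2 * (p : ℕ) := by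
  induction p with
  | one => simp [Computability.encodePosNum]
  | bit1 p ih =>
    simp only [Computability.encodePosNum, PosNum.cast_bit1, List.length_cons, pow_succ]
    omega
  | bit0 p ih =>
    simp only [Computability.encodePosNum, PosNum.cast_bit0, List.length_cons, pow_succ]
    omega

/-- The binary length determines a positive number up to a factor 2, which is all the precision that
the threshold test needs. -/
theorem length_encodeNat (k : ℕ) :
    k < 2 ^ (Computability.encodeNat k).length ∧
      2 ^ (Computability.encodeNat k).length ≤ 2 * k + 1 := by
  have h := Num.to_of_nat k
  unfold Computability.encodeNat
  cases hk : (k : Num) with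
  | zero =>
    rw [hk] at h
    subst h
    simp [Computability.encodeNum]
  | pos p =>
    rw [hk] at h
    have hp := length_encodePosNum p
    have h' : (p : ℕ) = k := h
    rw [h'] at hp
    exact ⟨hp.1, hp.2.trans (by omega)⟩

theorem map_val_finRange (n : ℕ) : (List.finRange n).map Fin.val = List.range n :=
  List.ext_getElem (by simp) (by simp)

theorem flatMap_finRange {β : Type} (n : ℕ) (f : ℕ → List β) :
    ((List.finRange n).flatMap fun i : Fin n => f (i : ℕ)) = (List.range n).flatMap f := by
  rw [← map_val_finRange, List.flatMap_map]

theorem encodeGraph_eq {n : ℕ} (G : SimpleGraph (Fin n)) :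
    encodeGraph G = encodeNum n ++ matrixCode n (adjBit G) := by
  have h : ∀ i : Fin n, ((List.finRange n).map fun j => open Classical in decide (G.Adj i j)) =
      (List.range n).map (adjBit G i) := by
    intro i
    rw [← map_val_finRange, List.map_map]
    refine List.map_congr_left fun j _ => ?_
    simp [adjBit]
  rw [encodeGraph, matrixCode, ← flatMap_finRange n fun i => (List.range n).map (adjBit G i)]
  congr 1
  refine List.flatMap_congr fun i _ => h i

theorem encodeElection_graphElection {n : ℕ} (D : ℕ) (G : SimpleGraph (Fin n)) :
    encodeElection (graphElection D G) =
      (List.range n).flatMap fun i => encodeNums (voteList n D i (adjBit G i)) := by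
  rw [← flatMap_finRange n fun i => encodeNums (voteList n D i (adjBit G i))]
  exact List.flatMap_congr fun i _ => flatMap_listVote_symm _ _ encodeNum

theorem encodeInstance_graphInstance {n D : ℕ} (hD : 0 < D) (G H : SimpleGraph (Fin n)) :
    encodeInstance (graphInstance D hD G H) = instanceCode n D (adjBit G) (adjBit H) := by
  have h1 := encodeElection_graphElection D G
  have h2 := encodeElection_graphElection D H
  unfold encodeInstance instanceCode
  rw [← h1, ← h2]
  rfl

end Encodings

/-! ### From programs to machines. -/

section Machine

/-- The machine which runs a program. -/
def toFinTM2 (tm : FinTM2) (P : Prog tm.Γ tm.σ) : FinTM2 where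
  K := Reg ⊕ tm.K
  kFin := @instFintypeSum _ _ _ tm.kFin
  k₀ := .inl .inp
  k₁ := .inl .res
  Γ := Sum.elim (fun _ => Bool) tm.Γ
  Λ := P.Λ
  main := P.entry
  ΛFin := P.fin
  σ := Option Bool × tm.σ
  initialState := (none, tm.initialState)
  σFin := @instFintypeProd _ _ _ tm.σFin
  Γk₀Fin := inferInstanceAs (Fintype Bool)
  m := P.code

theorem outputs_of_runs (tm : FinTM2) (P : Prog tm.Γ tm.σ) {l l' o : List Bool} {b : Bool} {T : ℕ}
    (hl : l = l') (ho : o = [b])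
    (h : Frag.Runs P (none, tm.initialState)
      (joinStacks (Function.update (fun _ => []) .inp l') fun _ => []) T
      (joinStacks (finalFile b) fun _ => [])) :
    Nonempty (TM2OutputsInTime (toFinTM2 tm P) l (some o) T) := by
  subst hl ho
  obtain ⟨t, ht, h⟩ := h
  refine ⟨⟨⟨t, ?_⟩, ht⟩⟩
  have h1 : initList (toFinTM2 tm P) l = ⟨some P.entry, (none, tm.initialState),
      joinStacks (Function.update (fun _ => []) .inp l) fun _ => []⟩ := by
    have hs : (initList (toFinTM2 tm P) l).stk =
        joinStacks (Function.update (fun _ => []) .inp l) fun _ => [] := by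
      refine ((initList_stk (toFinTM2 tm P) _).trans ?_).trans (update_joinStacks_inl (fun _ : Reg => ([] : List Bool))
        (fun _ : tm.K => []) .inp l)
      congr 1
      funext k
      cases k <;> rfl
    rw [← hs]
    rfl
  have h2 : haltList (toFinTM2 tm P) [b] = ⟨none, (none, tm.initialState),
      joinStacks (finalFile b) fun _ => []⟩ := by
    have hs : (haltList (toFinTM2 tm P) [b]).stk =
        joinStacks (finalFile b) fun _ => [] := by
      have hf : finalFile b = Function.update (fun _ => []) .res [b] := by
        funext k
        cases k <;> simp [finalFile]
      rw [hf]
      refine ((haltList_stk (toFinTM2 tm P) _).trans ?_).trans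
        (update_joinStacks_inl (fun _ : Reg => ([] : List Bool)) (fun _ : tm.K => []) .res [b])
      congr 1
      funext k
      cases k <;> rfl
    rw [← hs]
    rfl
  rw [h1]
  exact h.iterate.trans (congrArg some h2.symm)

end Machine

/-! ### The reduction in polynomial time and the inapproximability. -/

theorem graphIsomorphismInP_of_polyTimeNat {f : Instance → ℕ} (hf : PolyTimeNat encodeInstance f)
    (q : ℕ) {g : ℕ → ℕ} (hg : PolyBdd g)
    (hlen : ∀ (n : ℕ) (hD : 0 < (n + 2) ^ q) (G H : SimpleGraph (Fin n)),
      (Computability.encodeNat (f (graphInstance ((n + 2) ^ q) hD G H))).length ≤ g n)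
    (hiso : ∀ (n : ℕ) (hD : 0 < (n + 2) ^ q) (G H : SimpleGraph (Fin n)),
      Nonempty (G ≃g H) ↔ 1 ≤ (n + 2) ^ q / 2 ^
        ((Computability.encodeNat (f (graphInstance ((n + 2) ^ q) hD G H))).length + 3)) :
    GraphIsomorphismInP := by
  obtain ⟨M⟩ := hf
  -- `p₁` bounds the time for equal vertex numbers; `p₂` and `p₃` bound the parts depending on `n`
  -- and on `n'` when they differ.
  obtain ⟨p₁, hp₁⟩ := (((((polyBdd_buildTime q).add ((polyBdd_graphTime q).add
    (((PolyBdd.const 5).mul .id).add (((PolyBdd.const 5).mul .id).add (.const 6))))).add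
    (((polyBdd_graphTime q).add ((((((PolyBdd.const 2).mul (polyBdd_codeLength q)).add
      ((polyBdd_codeLength q).eval M.time))).add ((PolyBdd.const 2).mul hg)).add (.const 2))).add
    ((((hg.mul (((PolyBdd.const 3).mul (polyBdd_dummies q)).add (.const 4))).add
      ((PolyBdd.const 9).mul (polyBdd_dummies q))).add
      ((PolyBdd.const 32).mul ((polyBdd_fileBound q).add hg))).add (.const 63))))))
  obtain ⟨p₂, hp₂⟩ := ((polyBdd_buildTime q).add (polyBdd_graphTime q)).add
    (((PolyBdd.const 5).mul .id).add ((PolyBdd.const 32).mul (polyBdd_fileBound q)))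
  obtain ⟨p₃, hp₃⟩ := ((PolyBdd.const 5).mul .id).add (((PolyBdd.const 32).mul
    ((PolyBdd.id.mul .id).add .id)).add (.const 25))
  dsimp only at hp₁ hp₂ hp₃
  have key : ∀ P : GraphPair, Nonempty (TM2OutputsInTime (toFinTM2 M.tm
      (mainProg M.tm M.inputAlphabet.symm M.outputAlphabet q)) ((encodeGraphPair P).map id)
      (some ([open Classical in decide (Nonempty (P.fst ≃g P.snd))].map id))
      ((p₁ + p₂ + p₃).eval (encodeGraphPair P).length)) := by
    rintro ⟨n, n', G, H⟩
    have hcode : encodeGraphPair ⟨n, n', G, H⟩ = encodeNum n ++ matrixCode n (adjBit G) ++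
        (encodeNum n' ++ matrixCode n' (adjBit H)) := by
      rw [encodeGraphPair, encodeGraph_eq, encodeGraph_eq]
    -- Vertex numbers are written in unary, so bounds in `n` and `n'` carry over to the input length
    -- by monotonicity.
    have hL : n ≤ (encodeGraphPair ⟨n, n', G, H⟩).length ∧
        n' ≤ (encodeGraphPair ⟨n, n', G, H⟩).length := by
      rw [hcode]
      simp only [List.length_append, length_encodeNum]
      omega
    generalize hLL : (encodeGraphPair ⟨n, n', G, H⟩).length = L at hL
    rw [hcode, Polynomial.eval_add, Polynomial.eval_add]
    refine outputs_of_runs _ _ (List.map_id _) (List.map_id _) ?_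
    by_cases hnn : n = n'
    · subst hnn
      have hD : 0 < (n + 2) ^ q := by positivity
      have hb : (open Classical in decide (Nonempty (G ≃g H))) = decide (1 ≤ (n + 2) ^ q / 2 ^
          ((Computability.encodeNat (f (graphInstance ((n + 2) ^ q) hD G H))).length + 3)) := by
        rw [decide_eq_decide]
        exact hiso n hD G H
      have hM := M.outputsFun (graphInstance ((n + 2) ^ q) hD G H)
      rw [encodeInstance_graphInstance] at hM
      have hr := runs_mainProg_of_eq M.tm M.inputAlphabet.symm M.outputAlphabet q
        (adjBit G) (adjBit H) (n := n)
        (l := Computability.encodeNat (f (graphInstance ((n + 2) ^ q) hD G H)))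
        (by simp [Function.comp_def]) hM
      rw [hb]
      refine hr.mono ?_ rfl
      have h1 := (hp₁ n).trans (eval_mono p₁ hL.1)
      have h2 := hlen n hD G H
      have h3 := eval_mono M.time (length_instanceCode_le n ((n + 2) ^ q) (adjBit G) (adjBit H))
      generalize (Computability.encodeNat (f (graphInstance ((n + 2) ^ q) hD G H))).length = k at *
      have h4 : k * (3 * (n + 2) ^ q + 4) ≤ g n * (3 * (n + 2) ^ q + 4) :=
        Nat.mul_le_mul_right _ h2
      simp only [prepareTime]
      omega
    · have hb : (open Classical in decide (Nonempty (G ≃g H))) = false := by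
        rw [decide_eq_false_iff_not]
        rintro ⟨φ⟩
        exact hnn (by simpa using Fintype.card_congr φ.toEquiv)
      rw [hb]
      refine (runs_mainProg_of_ne M.tm M.inputAlphabet.symm M.outputAlphabet q hnn
        (adjBit G) (adjBit H)).mono ?_ rfl
      have h2 := (hp₂ n).trans (eval_mono p₂ hL.1)
      have h3 := (hp₃ n').trans (eval_mono p₃ hL.2)
      simp only [prepareTime]
      omega
  exact ⟨{
    tm := toFinTM2 M.tm (mainProg M.tm M.inputAlphabet.symm M.outputAlphabet q)
    inputAlphabet := Equiv.refl Bool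
    outputAlphabet := Equiv.refl Bool
    time := p₁ + p₂ + p₃
    outputsFun := fun P => Classical.choice (key P) }⟩

/-- The hypotheses on `opt` are weak enough to hold for both distances: completeness of the
reduction needs the swap upper bound, soundness the Spearman lower bound. -/
theorem not_hasPolyTimeApprox (hGI : ¬ GraphIsomorphismInP) {α : ℝ} (hα : 1 ≤ α)
    {opt : Instance → ℕ} (hle : ∀ I, opt I ≤ 2 * swapID I) (hge : ∀ I, spearID I ≤ 2 * opt I) :
    ¬ HasPolyTimeApprox opt (fun I => (I.numVoters : ℝ) ^ α) := by
  rintro ⟨f, hf, happrox⟩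
  apply hGI
  set k := ⌈α⌉₊ with hk
  have hlow : ∀ I, opt I ≤ f I := fun I => (happrox I).1
  have hupp : ∀ I, f I ≤ I.numVoters ^ k * opt I := by
    intro I
    have h1 : ((I.numVoters : ℝ)) ^ α ≤ (I.numVoters : ℝ) ^ k := by
      rcases Nat.eq_zero_or_pos I.numVoters with h0 | h0
      -- Without voters the ratio is `0 ^ α`, which is `0` because `α ≠ 0`.
      · rw [h0, Nat.cast_zero, Real.zero_rpow (by linarith)]
        positivity
      · rw [← Real.rpow_natCast]
        exact Real.rpow_le_rpow_of_exponent_le (by exact_mod_cast h0) (Nat.le_ceil α)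
    have h2 := (happrox I).2.trans (mul_le_mul_of_nonneg_right h1 (Nat.cast_nonneg (opt I)))
    exact_mod_cast h2
  -- In `k + 8`, the ratio accounts for `k` and the bound `n ^ 3` for 3. The other 5 absorb the
  -- constant `32 = 2 ^ 5`: a factor 2 from `hle`, a factor 2 from the binary length, and the 8 of
  -- the test.
  refine graphIsomorphismInP_of_polyTimeNat hf (k + 8)
    (g := fun n => 2 * (n ^ k * (2 * (n * ((n + 2 * (n + 2) ^ (k + 8)) *
      (n + 2 * (n + 2) ^ (k + 8)))))) + 1) ?_ ?_ ?_
  · exact ((PolyBdd.const 2).mul ((PolyBdd.id.pow k).mul ((PolyBdd.const 2).mul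
      (PolyBdd.id.mul ((polyBdd_numCand _).mul (polyBdd_numCand _)))))).add (.const 1)
  · intro n hD G H
    set I := graphInstance ((n + 2) ^ (k + 8)) hD G H with hI
    have h1 : f I ≤ n ^ k * opt I := hupp I
    have h2 : swapID I ≤ n * ((n + 2 * (n + 2) ^ (k + 8)) * (n + 2 * (n + 2) ^ (k + 8))) :=
      swapID_le I
    have h3 := h1.trans (Nat.mul_le_mul_left (n ^ k) ((hle I).trans (Nat.mul_le_mul_left 2 h2)))
    have h4 := (length_encodeNat (f I)).2
    -- The length is bounded through `ℓ < 2 ^ ℓ ≤ 2 * f I + 1`, which is wasteful but polynomial.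
    have h5 := Nat.lt_two_pow_self (n := (Computability.encodeNat (f I)).length)
    omega
  · intro n hD G H
    set I := graphInstance ((n + 2) ^ (k + 8)) hD G H with hI
    obtain ⟨hl1, hl2⟩ := length_encodeNat (f I)
    rw [Nat.one_le_div_iff (by positivity), pow_add]
    constructor
    · rintro ⟨φ⟩
      have h1 : f I ≤ n ^ k * opt I := hupp I
      have h2 : swapID I ≤ n * (n * n) := swapID_graphInstance_le hD φ
      have h3 := h1.trans (Nat.mul_le_mul_left (n ^ k) ((hle I).trans (Nat.mul_le_mul_left 2 h2)))
      have h4 : n ^ k * (2 * (n * (n * n))) = 2 * n ^ (k + 3) := by ring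
      have h5 : n ^ (k + 3) + 1 ≤ (n + 2) ^ (k + 3) :=
        Nat.pow_lt_pow_left (by omega) (by omega)
      have h6 : (n + 2) ^ (k + 3) * 32 ≤ (n + 2) ^ (k + 8) := by
        rw [show k + 8 = k + 3 + 5 by ring, pow_add (n + 2) (k + 3) 5]
        refine Nat.mul_le_mul_left _ ?_
        exact (show 32 = 2 ^ 5 by norm_num) ▸ Nat.pow_le_pow_left (by omega) 5
      omega
    -- If the test succeeds, then `f I < D / 8`, so `2 * spearID I ≤ 4 * f I < D / 2`, while `n < D
    -- / 2` by the size of `D`.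
    · intro hlt
      refine nonempty_iso_of_spearID_lt hD ?_
      have h1 := hge I
      have h2 := hlow I
      have h3 : n + 2 ≤ (n + 2) ^ (k + 8 - 1) := Nat.le_self_pow (by omega) _
      have h4 : 2 * (n + 2) ≤ (n + 2) ^ (k + 8) := by
        rw [show k + 8 = (k + 8 - 1) + 1 by omega, pow_succ, mul_comm]
        exact Nat.mul_le_mul h3 (by omega)
      change 2 * spearID I + n < _
      omega

end ElectionIso

theorem mainTheorem4 (hGI : ¬ ElectionIso.GraphIsomorphismInP) (α : ℝ) (hα : 1 ≤ α) :
    (¬ ElectionIso.HasPolyTimeApprox ElectionIso.spearID (fun I => (I.numVoters : ℝ) ^ α)) ∧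
    (¬ ElectionIso.HasPolyTimeApprox ElectionIso.swapID (fun I => (I.numVoters : ℝ) ^ α)) :=
  ⟨ElectionIso.not_hasPolyTimeApprox hGI hα ElectionIso.spearID_le_two_mul_swapID fun I => by omega,
    ElectionIso.not_hasPolyTimeApprox hGI hα (fun I => by omega)
      ElectionIso.spearID_le_two_mul_swapID⟩
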